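/- For a finite group $G=\{g_1,\dots,g_n\}$ let $S(G)$ be the set of all integers $\det\big(x_{g_ig_j^{-1}}\big)_{1\le i,j\le n}$, where the variables $x_{g_1},\dots,x_{g_n}$ run through all integers. Let $\mathcal P_1$ be the set of primes $p\equiv 1 \bmod 12$ of the form $p=(6k+2)^2+(6t+3)^2$ with $k,t\in\mathbb Z$. **Theorem.** Let $G=\mathbb Z_6\times\mathbb Z_2$. Then $S(G)=A\cup B\cup C$, where $A$, $B$, $C$ are the following sets of integers; throughout, $m$ runs through all integers. (a) $A$ consists of the integers $$3^3(4m-1),\quad 2^4\cdot 3^3(2m-1),\quad 2^6\cdot 3^3m .$$ (b) $B$ consists of the integers $$3^2(4m-1)p,\quad 2^4\cdot 3^2(2m-1)p,\quad 2^6\cdot 3^2mp\qquad (p\equiv 7 \bmod 12 \text{ prime}),$$ $$2^8\cdot 3^2(4m-1),\quad 2^{10}\cdot 3^2(4m-1),\quad 2^{12}\cdot 3^2(2m-1),\quad 2^{14}\cdot 3^2m .$$ (c) $C$ consists of the integers $$12m+1,\quad 2^4(6m+1),\quad 2^6(3m+1);$$ $$(12m+5)k,\quad -2^4(6m+1)k,\quad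 -2^6(3m+1)k,$$ where $k$ is a prime in $\mathcal P_1$, or $k=p^2$ for a prime $p\equiv 5\bmod 12$, or $k=p_1p_2$ for (not necessarily distinct) primes $p_1,p_2\equiv 7\bmod 12$; $$2^8(12m+5),\quad 2^8(12m+5)p,\quad 2^{10}(12m+5),\quad 2^{10}(12m+5)p\qquad (p\equiv 7\bmod 12\text{ prime});$$ $$-2^{12}(6m+1),\quad -2^{14}(3m+1).$$ Moreover, the elements of $S(G)$ divisible by $3^3$ are exactly those of $A$; the elements of $S(G)$ divisible by $3^2$ but not by $3^3$ are exactly the elements of $B$ not divisible by $3^3$; the elements of $S(G)$ not divisible by $3$ are exactly those of $C$; and no element of $S(G)$ is divisible by $3$ but not by $9$. -/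

import Mathlib

/-- The integer group determinant of a finite group `G`, written additively: the determinant of
the matrix, with rows and columns indexed by `G`, whose `(g, h)` entry is `x (g - h)` (that is,
`x_{g h⁻¹}` in multiplicative notation). -/
def groupDeterminant {G : Type*} [AddGroup G] [Fintype G] [DecidableEq G] (x : G → ℤ) : ℤ :=
  Matrix.det (Matrix.of fun g h : G => x (g - h))

/-- `S(G)`: the set of all integer group determinants of `G`, the variables running through all
integers. -/
def groupDeterminantSet (G : Type*) [AddGroup G] [Fintype G] [DecidableEq G] : Set ℤ :=
  Set.range fun x : G → ℤ => groupDeterminant x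

/-- The primes `p ≡ 1 mod 12` of the form `(6k+2)² + (6t+3)²` with `k, t ∈ ℤ`. -/
def primesP1 : Set ℕ :=
  {p | p.Prime ∧ p % 12 = 1 ∧ ∃ k t : ℤ, (p : ℤ) = (6 * k + 2) ^ 2 + (6 * t + 3) ^ 2}

/-- The admissible factors `k`: a prime in `P₁`, the square of a prime `≡ 5 mod 12`, or a product
of two (not necessarily distinct) primes `≡ 7 mod 12`. -/
def admissibleFactors : Set ℕ :=
  {k | k ∈ primesP1 ∨
    (∃ p : ℕ, p.Prime ∧ p % 12 = 5 ∧ k = p ^ 2) ∨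
    (∃ p₁ p₂ : ℕ, p₁.Prime ∧ p₁ % 12 = 7 ∧ p₂.Prime ∧ p₂ % 12 = 7 ∧ k = p₁ * p₂)}

/-- The integers `3³(4m-1)`, `2⁴·3³(2m-1)`, `2⁶·3³m`. -/
def formsA : Set ℤ :=
  {n | ∃ m : ℤ, n = 3 ^ 3 * (4 * m - 1) ∨ n = 2 ^ 4 * 3 ^ 3 * (2 * m - 1) ∨
    n = 2 ^ 6 * 3 ^ 3 * m}

/-- The integers `3²(4m-1)p`, `2⁴·3²(2m-1)p`, `2⁶·3²mp` with `p ≡ 7 mod 12` prime, together with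
`2⁸·3²(4m-1)`, `2¹⁰·3²(4m-1)`, `2¹²·3²(2m-1)`, `2¹⁴·3²m`. -/
def formsB : Set ℤ :=
  {n | ∃ m : ℤ,
    (∃ p : ℕ, p.Prime ∧ p % 12 = 7 ∧
      (n = 3 ^ 2 * (4 * m - 1) * p ∨ n = 2 ^ 4 * 3 ^ 2 * (2 * m - 1) * p ∨
        n = 2 ^ 6 * 3 ^ 2 * m * p)) ∨
    n = 2 ^ 8 * 3 ^ 2 * (4 * m - 1) ∨ n = 2 ^ 10 * 3 ^ 2 * (4 * m - 1) ∨
    n = 2 ^ 12 * 3 ^ 2 * (2 * m - 1) ∨ n = 2 ^ 14 * 3 ^ 2 * m}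

/-- The integers `12m+1`, `2⁴(6m+1)`, `2⁶(3m+1)`; `(12m+5)k`, `-2⁴(6m+1)k`, `-2⁶(3m+1)k` with `k`
an admissible factor; `2⁸(12m+5)`, `2¹⁰(12m+5)`, `2⁸(12m+5)p`, `2¹⁰(12m+5)p` with `p ≡ 7 mod 12`
prime; `-2¹²(6m+1)`, `-2¹⁴(3m+1)`. -/
def formsC : Set ℤ :=
  {n | ∃ m : ℤ,
    (n = 12 * m + 1 ∨ n = 2 ^ 4 * (6 * m + 1) ∨ n = 2 ^ 6 * (3 * m + 1)) ∨
    (∃ k ∈ admissibleFactors,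
      n = (12 * m + 5) * k ∨ n = -2 ^ 4 * (6 * m + 1) * k ∨ n = -2 ^ 6 * (3 * m + 1) * k) ∨
    (n = 2 ^ 8 * (12 * m + 5) ∨ n = 2 ^ 10 * (12 * m + 5)) ∨
    (∃ p : ℕ, p.Prime ∧ p % 12 = 7 ∧
      (n = 2 ^ 8 * (12 * m + 5) * p ∨ n = 2 ^ 10 * (12 * m + 5) * p)) ∨
    (n = -2 ^ 12 * (6 * m + 1) ∨ n = -2 ^ 14 * (3 * m + 1))}

/-!
# The integer group determinants of `ZMod 6 × ZMod 2`

The group is the product of `ZMod 3` and the Klein four-group `V`. Over `ℤ[ω]`, which contains the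
sixth roots of unity, the group matrix is diagonalized by the characters, and as `ℤ[ZMod 3]` is the
ring of pairs in `ℤ × ℤ[ω]` that are congruent modulo `√-3`, the group determinants are the
integers `a N(x)`, where `a` and `x` are group determinants of `V` over `ℤ` and over `ℤ[ω]` with
entries that are congruent modulo `√-3` (`GroupDet.mem_groupDeterminantSet_iff`). In particular
`x ≡ a mod √-3`.

A determinant of `V` is the fourth power of the sum of its entries modulo `4`, and it is `16` times
a product of four elements with an even sum if that sum is even. So `a` is `1 mod 4`, or `16` times
an odd number, or a multiple of `64`, and `x` is a power of `ω` modulo `4` ("primary") or a multiple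
of `16`. Conversely, determinants of `V` in which all but one of the four factors are `1`, or small,
realize all the listed integers (`KleinDet.mem_of_shape`).

If `3` divides `a N(x)`, then it divides both factors, and a count of powers of `3` and `2` is all
that is needed, together with the fact that a norm that is `7 mod 12` has a prime factor that is
`7 mod 12` (`Eis.exists_prime_dvd_norm`).

If `a N(x)` is `2 mod 3`, then `x ≡ -1 mod √-3`. The crucial point is that the norm of a primary `x`
with `x ≡ -1 mod √-3` has an admissible factor (`Eis.IsPrimary.exists_admissible_dvd_norm`), and
that every admissible factor is such a norm (`Eis.exists_norm_eq_of_mem_admissibleFactors`). For a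
prime `p ≡ 1 mod 12` this is a reciprocity law (`Eis.IsPrimary.exists_eq_sq_add_sq`): a primary
element `x` of norm `p` is `-1` modulo `√-3` if and only if `p` is the sum of an even square and the
square of an odd multiple of `3`. To see this, one writes `±x = c² + d²` in `ℤ[ω]`, by descent. Then
`c + d i` has the norms `±x` and `(N(c) - N(d)) + Tr(c d̄) i` in `ℤ[ω]` and in `ℤ[i]`, and both can be
compared modulo `12`.
-/

/-! ### Arithmetic of the Eisenstein integers -/

/-- The ring `ℤ[ω]` of Eisenstein integers: `⟨r, s⟩` stands for `r + s ω`, where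
`ω² = -1 - ω`. -/
abbrev Eis : Type := QuadraticAlgebra ℤ (-1) (-1)

namespace Eis

open QuadraticAlgebra

/-- The primitive cube root of unity `ω`. -/
def om : Eis := ⟨0, 1⟩

/-- The element `√-3 = 1 + 2ω`, which generates the prime ideal above `3`. -/
def sqrtNegThree : Eis := ⟨1, 2⟩

lemma norm_eq (z : Eis) : norm z = z.re ^ 2 - z.re * z.im + z.im ^ 2 := by
  rw [norm_def]; ring

lemma norm_nonneg (z : Eis) : 0 ≤ norm z := by
  rw [norm_eq]; nlinarith [sq_nonneg (2 * z.re - z.im), sq_nonneg z.im]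

lemma norm_eq_zero {z : Eis} : norm z = 0 ↔ z = 0 := by
  constructor
  · intro h
    rw [norm_eq] at h
    have h2 : z.im = 0 := by
      nlinarith [sq_nonneg (2 * z.re - z.im), sq_nonneg z.im]
    have h1 : z.re = 0 := by
      rw [h2] at h; nlinarith
    ext <;> simp [h1, h2]
  · rintro rfl; simp

lemma norm_pos {z : Eis} (h : z ≠ 0) : 0 < norm z :=
  lt_of_le_of_ne (norm_nonneg z) fun h' => h (norm_eq_zero.1 h'.symm)

lemma norm_om : norm om = 1 := by rw [norm_eq]; norm_num [om]

lemma norm_sqrtNegThree : norm sqrtNegThree = 3 := by rw [norm_eq]; norm_num [sqrtNegThree]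

/-- Division with remainder, with the best constant: every point of an equilateral triangle with
side `|y|` is at distance at most `|y| / √3` from one of the vertices. The constant matters for the
descent in `exists_sq_add_sq_eq_unit_mul`. -/
lemma exists_three_mul_norm_sub_le (x : Eis) {y : Eis} (hy : y ≠ 0) :
    ∃ q : Eis, 3 * norm (x - y * q) ≤ norm y := by
  set n := norm y with hn
  have hn0 : 0 < n := norm_pos hy
  -- Multiplying by `star y` turns the divisor into the integer `n`.
  have key : ∀ q : Eis, norm (x * star y - (n : Eis) * q) = norm (x - y * q) * n := by
    intro q
    have h : x * star y - (n : Eis) * q = (x - y * q) * star y := by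
      have := algebraMap_norm_eq_mul_star y
      rw [algebraMap_int_eq, eq_intCast, ← hn] at this
      rw [this]; ring
    rw [h, map_mul, QuadraticAlgebra.norm_star]
  suffices H : ∃ q : Eis, 3 * norm (x * star y - (n : Eis) * q) ≤ n ^ 2 by
    obtain ⟨q, hq⟩ := H
    refine ⟨q, ?_⟩
    rw [key] at hq
    nlinarith
  generalize x * star y = z
  set u := z.re % n with hu
  set v := z.im % n with hv
  have hu0 : 0 ≤ u := Int.emod_nonneg _ hn0.ne'
  have hv0 : 0 ≤ v := Int.emod_nonneg _ hn0.ne'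
  have hu1 : u < n := Int.emod_lt_of_pos _ hn0
  have hv1 : v < n := Int.emod_lt_of_pos _ hn0
  have hzu : z.re = n * (z.re / n) + u := (Int.mul_ediv_add_emod _ _).symm
  have hzv : z.im = n * (z.im / n) + v := (Int.mul_ediv_add_emod _ _).symm
  generalize z.re / n = i at hzu
  generalize z.im / n = j at hzv
  have form : ∀ a b : ℤ, norm (z - (n : Eis) * ⟨i + a, j + b⟩) =
      (u - n * a) ^ 2 - (u - n * a) * (v - n * b) + (v - n * b) ^ 2 := by
    intro a b
    rw [norm_eq]
    simp [hzu, hzv]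
    ring
  by_contra! hcon
  have h0 := hcon ⟨i + 0, j + 0⟩
  have h1 := hcon ⟨i + 1, j + 1⟩
  rw [form] at h0 h1
  -- With the barycentric coordinates of the point as weights, the mean squared distance to the
  -- three vertices of the triangle around it is at most the squared circumradius.
  rcases le_total v u with h | h
  · have h2 := hcon ⟨i + 1, j + 0⟩
    rw [form] at h2
    nlinarith [mul_nonneg (sub_nonneg.2 hu1.le) (sub_nonneg.2 h0.le),
      mul_nonneg (sub_nonneg.2 h) (sub_nonneg.2 h2.le), mul_nonneg hv0 (sub_nonneg.2 h1.le),
      mul_pos (sub_pos.2 hu1) (sub_pos.2 h0), sq_nonneg (3 * v - n), sq_nonneg (3 * u - 2 * n),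
      mul_nonneg hn0.le (sq_nonneg (2 * u - v - n)), mul_nonneg hn0.le (sq_nonneg (3 * v - n))]
  · have h2 := hcon ⟨i + 0, j + 1⟩
    rw [form] at h2
    nlinarith [mul_nonneg (sub_nonneg.2 hv1.le) (sub_nonneg.2 h0.le),
      mul_nonneg (sub_nonneg.2 h) (sub_nonneg.2 h2.le), mul_nonneg hu0 (sub_nonneg.2 h1.le),
      mul_pos (sub_pos.2 hv1) (sub_pos.2 h0),
      mul_nonneg hn0.le (sq_nonneg (2 * v - u - n)), mul_nonneg hn0.le (sq_nonneg (3 * u - n))]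

instance : IsDomain Eis :=
  haveI : NoZeroDivisors Eis := ⟨fun {a b} h => by
    have := congrArg QuadraticAlgebra.norm h
    rw [map_mul, QuadraticAlgebra.norm_zero, mul_eq_zero, norm_eq_zero, norm_eq_zero] at this
    exact this⟩
  NoZeroDivisors.to_isDomain _

open Classical in
noncomputable instance : EuclideanDomain Eis :=
  { (inferInstance : CommRing Eis), (inferInstance : Nontrivial Eis) with
    quotient := fun x y => if h : y = 0 then 0 else (exists_three_mul_norm_sub_le x h).choose
    remainder := fun x y =>
      if h : y = 0 then x else x - y * (exists_three_mul_norm_sub_le x h).choose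
    quotient_zero := fun x => by simp
    quotient_mul_add_remainder_eq := fun x y => by
      by_cases h : y = 0 <;> simp [h]
    r := fun x y => (norm x).natAbs < (norm y).natAbs
    r_wellFounded := (measure fun x : Eis => (norm x).natAbs).wf
    remainder_lt := fun x y h => by
      have := (exists_three_mul_norm_sub_le x h).choose_spec
      have h1 := norm_pos h
      simp only [h, dite_false]
      have h2 := norm_nonneg (x - y * (exists_three_mul_norm_sub_le x h).choose)
      omega
    mul_left_not_lt := fun x y h => by
      rw [map_mul, Int.natAbs_mul, not_lt]
      have := norm_pos h
      exact Nat.le_mul_of_pos_right _ (by omega) }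

/-- A rational prime dividing the norm of `z` divides `z` or is the norm of a divisor of `z`. -/
lemma dvd_or_exists_norm_eq {p : ℕ} (hp : p.Prime) {z : Eis} (h : (p : ℤ) ∣ norm z) :
    (p : Eis) ∣ z ∨ ∃ x : Eis, norm x = p ∧ x ∣ z := by
  obtain ⟨d, hd⟩ := (IsPrincipalIdealRing.principal (Ideal.span {(p : Eis), z})).principal
  have hdp : d ∣ (p : Eis) := by
    rw [← Ideal.mem_span_singleton, ← Ideal.submodule_span_eq, ← hd]
    exact Ideal.subset_span (by simp)
  have hdz : d ∣ z := by
    rw [← Ideal.mem_span_singleton, ← Ideal.submodule_span_eq, ← hd]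
    exact Ideal.subset_span (by simp)
  have hdn : norm d ∣ (p : ℤ) ^ 2 := by
    rw [← QuadraticAlgebra.norm_natCast (a := -1) (b := -1) p]; exact map_dvd QuadraticAlgebra.norm hdp
  obtain ⟨i, hi, hdi⟩ := (Nat.dvd_prime_pow hp).1
    (show (norm d).natAbs ∣ p ^ 2 by simpa [Int.natAbs_pow] using Int.natAbs_dvd_natAbs.2 hdn)
  have hdi' : norm d = (p : ℤ) ^ i := by
    rw [← Int.natAbs_of_nonneg (norm_nonneg d), hdi]; push_cast; rfl
  interval_cases i
  · left
    have hu : IsUnit d := isUnit_iff_norm_isUnit.2 (by rw [hdi']; simp)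
    have h1 : (1 : Eis) ∈ Ideal.span {(p : Eis), z} := by
      rw [hd, Ideal.submodule_span_eq, Ideal.mem_span_singleton]; exact hu.dvd
    obtain ⟨a, b, hab⟩ := Ideal.mem_span_pair.1 h1
    have hz : (p : Eis) ∣ z * star z := by
      rw [← algebraMap_norm_eq_mul_star]
      obtain ⟨c, hc⟩ := h
      exact ⟨c, by rw [hc]; simp⟩
    have hs : (p : Eis) ∣ star z := by
      have : star z = p * (a * star z) + b * (z * star z) := by
        linear_combination (-star z) * hab
      rw [this]
      exact dvd_add (dvd_mul_right _ _) (hz.mul_left _)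
    obtain ⟨c, hc⟩ := hs
    exact ⟨star c, by rw [← star_star z, hc]; simp [mul_comm]⟩
  · exact Or.inr ⟨d, by simpa using hdi', hdz⟩
  · left
    obtain ⟨c, hc⟩ := hdp
    have hcn := congrArg QuadraticAlgebra.norm hc
    rw [map_mul, QuadraticAlgebra.norm_natCast, hdi'] at hcn
    have hp0 : (p : ℤ) ^ 2 ≠ 0 := pow_ne_zero _ (by exact_mod_cast hp.ne_zero)
    have hcu : IsUnit c := isUnit_iff_norm_isUnit.2 (by
      rw [mul_right_eq_self₀.1 hcn.symm |>.resolve_right hp0]; exact isUnit_one)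
    rw [hc]
    exact (hcu.mul_right_dvd).2 hdz

/-- A prime `p ≡ 1 mod 3` is a norm: `h - ω`, with `h² + h + 1 ≡ 0 mod p`, is not divisible
by `p`, but its norm is. -/
lemma exists_norm_eq {p : ℕ} (hp : p.Prime) (h3 : p % 3 = 1) : ∃ x : Eis, norm x = p := by
  have := Fact.mk hp
  have := Fact.mk Nat.prime_three
  obtain ⟨g, hg⟩ := exists_prime_orderOf_dvd_card (G := (ZMod p)ˣ) 3
    (by rw [ZMod.card_units_eq_totient, Nat.totient_prime hp]; omega)
  have hg1 : (g : ZMod p) - 1 ≠ 0 := fun h => by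
    have h1 : g = 1 := Units.ext (by simpa using sub_eq_zero.1 h)
    simp [h1] at hg
  have hg3 : (g : ZMod p) ^ 3 = 1 := by
    rw [← Units.val_pow_eq_pow_val, ← hg, pow_orderOf_eq_one, Units.val_one]
  have hroot : (g : ZMod p) ^ 2 + g + 1 = 0 :=
    (mul_eq_zero.1 (by linear_combination hg3 :
      ((g : ZMod p) - 1) * ((g : ZMod p) ^ 2 + g + 1) = 0)).resolve_left hg1
  obtain ⟨h, hh⟩ := ZMod.intCast_surjective (g : ZMod p)
  have hdvd : (p : ℤ) ∣ QuadraticAlgebra.norm (⟨h, -1⟩ : Eis) := by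
    rw [norm_eq, ← ZMod.intCast_zmod_eq_zero_iff_dvd]
    push_cast
    rw [hh]
    linear_combination hroot
  rcases dvd_or_exists_norm_eq hp hdvd with hd | ⟨x, hx, -⟩
  · obtain ⟨c, hc⟩ := hd
    have := congrArg QuadraticAlgebra.im hc
    simp at this
    have h1 : (p : ℤ) ∣ 1 := ⟨-c.im, by linarith⟩
    have := Int.le_of_dvd one_pos h1
    have := hp.two_le
    omega
  · exact ⟨x, hx⟩

end Eis

/-! ### Congruences modulo `√-3`, `2` and `4` -/

namespace Eis

open QuadraticAlgebra

/-- Reduction `ℤ[ω] → ℤ[ω]/(√-3) = 𝔽₃`, which sends `ω` to `1`. -/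
def residue : Eis →+* ZMod 3 where
  toFun z := z.re + z.im
  map_one' := by simp
  map_zero' := by simp
  map_add' x y := by simp; ring
  map_mul' x y := by
    simp only [re_mul, im_mul]
    push_cast
    linear_combination (-x.im * y.im : ZMod 3) * (by decide : (3 : ZMod 3) = 0)

lemma residue_apply (z : Eis) : residue z = z.re + z.im := rfl

lemma residue_eq_intCast_iff {z : Eis} {n : ℤ} :
    residue z = n ↔ (3 : ℤ) ∣ n - (z.re + z.im) := by
  rw [residue_apply, ← Int.cast_add, ZMod.intCast_eq_intCast_iff_dvd_sub]; norm_cast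

lemma norm_cast_zmod_three (z : Eis) : ((QuadraticAlgebra.norm z : ℤ) : ZMod 3) = residue z ^ 2 := by
  rw [norm_eq, residue_apply]; push_cast
  linear_combination (-z.re * z.im : ZMod 3) * (by decide : (3 : ZMod 3) = 0)

lemma residue_star (z : Eis) : residue (star z) = residue z := by
  simp only [residue_apply, re_star, im_star]; push_cast
  linear_combination (-z.im : ZMod 3) * (by decide : (3 : ZMod 3) = 0)

lemma residue_om : residue om = 1 := by simp [residue_apply, om]

lemma exists_eq_sqrtNegThree_mul {z : Eis} (h : residue z = 0) :
    ∃ c : Eis, z = sqrtNegThree * c := by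
  rw [← Int.cast_zero, residue_eq_intCast_iff] at h
  obtain ⟨k, hk⟩ := h
  refine ⟨⟨z.im + k, -k - z.re⟩, ?_⟩
  ext <;> simp [sqrtNegThree] <;> linarith

lemma four_dvd_iff {z : Eis} : (4 : Eis) ∣ z ↔ (z.re : ZMod 4) = 0 ∧ (z.im : ZMod 4) = 0 := by
  rw [ZMod.intCast_zmod_eq_zero_iff_dvd, ZMod.intCast_zmod_eq_zero_iff_dvd]
  exact algebraMap_dvd_iff (r := (4 : ℤ))

lemma two_dvd_iff {z : Eis} : (2 : Eis) ∣ z ↔ (2 : ℤ) ∣ z.re ∧ (2 : ℤ) ∣ z.im :=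
  algebraMap_dvd_iff (r := (2 : ℤ))

lemma emod_four_eq_iff (n m : ℤ) : n % 4 = m % 4 ↔ (n : ZMod 4) = m :=
  (ZMod.intCast_eq_intCast_iff' n m 4).symm

/-- `z` is *primary* if it is congruent to a power of `ω` modulo `4`. As the units modulo `4` form
a group of type `(3, 2, 2)`, this is the case if and only if `z³ ≡ 1 mod 4`. -/
def IsPrimary (z : Eis) : Prop := (4 : Eis) ∣ z ^ 3 - 1

lemma IsPrimary.of_mul {x y : Eis} (hx : IsPrimary x) (hxy : IsPrimary (x * y)) :
    IsPrimary y := by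
  have : y ^ 3 - 1 = ((x * y) ^ 3 - 1) - (x ^ 3 - 1) * y ^ 3 := by ring
  rw [IsPrimary, this]
  exact dvd_sub hxy (hx.mul_right _)

lemma IsPrimary.congr {x y : Eis} (hx : IsPrimary x) (h : (4 : Eis) ∣ y - x) : IsPrimary y := by
  have : y ^ 3 - 1 = (x ^ 3 - 1) + (y - x) * (y ^ 2 + y * x + x ^ 2) := by ring
  rw [IsPrimary, this]
  exact dvd_add hx (h.mul_right _)

lemma IsPrimary.norm_emod_four {z : Eis} (h : IsPrimary z) : QuadraticAlgebra.norm z % 4 = 1 := by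
  rw [IsPrimary, four_dvd_iff] at h
  refine (emod_four_eq_iff _ 1).2 ?_
  rw [norm_eq]
  simp [pow_succ] at h
  push_cast
  generalize (z.re : ZMod 4) = r at *
  generalize (z.im : ZMod 4) = s at *
  revert r s; decide

lemma isPrimary_or_neg {z : Eis} (h : QuadraticAlgebra.norm z % 4 = 1) :
    IsPrimary z ∨ IsPrimary (-z) := by
  replace h := (emod_four_eq_iff _ 1).1 h
  rw [norm_eq] at h
  rw [IsPrimary, four_dvd_iff, IsPrimary, four_dvd_iff]
  push_cast at h
  simp [pow_succ]
  generalize (z.re : ZMod 4) = r at *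
  generalize (z.im : ZMod 4) = s at *
  revert r s; decide

lemma isPrimary_pow_four {z : Eis} (h : QuadraticAlgebra.norm z % 2 = 1) : IsPrimary (z ^ 4) := by
  have h : QuadraticAlgebra.norm z % 4 = 1 % 4 ∨ QuadraticAlgebra.norm z % 4 = 3 % 4 := by omega
  rw [emod_four_eq_iff, emod_four_eq_iff, norm_eq] at h
  -- It is enough that the sixth power is `1` modulo `4`.
  suffices H : (4 : Eis) ∣ z ^ 6 - 1 by
    have : (z ^ 4) ^ 3 - 1 = (z ^ 6 - 1) * (z ^ 6 + 1) := by ring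
    rw [IsPrimary, this]
    exact H.mul_right _
  rw [four_dvd_iff]
  push_cast at h
  simp [pow_succ]
  generalize (z.re : ZMod 4) = r at *
  generalize (z.im : ZMod 4) = s at *
  revert r s; decide

/-- If the norm of `x` is `3` modulo `4`, then `x³ ≡ ±√-3 mod 4` changes its sign under
conjugation. -/
lemma IsPrimary.neg_star_mul {x y : Eis} (h : IsPrimary (x * y))
    (hx : QuadraticAlgebra.norm x % 4 = 3) : IsPrimary (-(star x * y)) := by
  have H : (4 : Eis) ∣ x ^ 3 + star x ^ 3 := by
    replace hx := (emod_four_eq_iff _ 3).1 hx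
    rw [norm_eq] at hx
    rw [four_dvd_iff]
    push_cast at hx
    simp [pow_succ]
    generalize (x.re : ZMod 4) = r at *
    generalize (x.im : ZMod 4) = s at *
    revert r s; decide
  have : (-(star x * y)) ^ 3 - 1 = ((x * y) ^ 3 - 1) - (x ^ 3 + star x ^ 3) * y ^ 3 := by ring
  rw [IsPrimary, this]
  exact dvd_sub h (H.mul_right _)

/-- Multiplication by a power of `ω` changes neither the norm nor the residue. -/
lemma IsPrimary.exists_four_dvd_sub_one {z : Eis} (h : IsPrimary z) :
    ∃ y : Eis, QuadraticAlgebra.norm y = QuadraticAlgebra.norm z ∧ residue y = residue z ∧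
      (4 : Eis) ∣ y - 1 := by
  have H : (4 : Eis) ∣ z - 1 ∨ (4 : Eis) ∣ om * z - 1 ∨ (4 : Eis) ∣ om * (om * z) - 1 := by
    rw [IsPrimary, four_dvd_iff] at h
    simp only [four_dvd_iff]
    simp [pow_succ] at h
    simp [om]
    generalize (z.re : ZMod 4) = r at *
    generalize (z.im : ZMod 4) = s at *
    revert r s; decide
  rcases H with H | H | H
  · exact ⟨_, rfl, rfl, H⟩
  · exact ⟨_, by rw [map_mul, norm_om, one_mul], by rw [map_mul, residue_om, one_mul], H⟩
  · exact ⟨_, by rw [map_mul, map_mul, norm_om, one_mul, one_mul],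
      by rw [map_mul, map_mul, residue_om, one_mul, one_mul], H⟩

/-- The units modulo `2` are the powers of `ω`. -/
lemma exists_two_dvd_sub_one {z : Eis} (h : QuadraticAlgebra.norm z % 2 = 1) :
    ∃ y : Eis, QuadraticAlgebra.norm y = QuadraticAlgebra.norm z ∧ residue y = residue z ∧
      (2 : Eis) ∣ y - 1 := by
  have H : (2 : Eis) ∣ z - 1 ∨ (2 : Eis) ∣ om * z - 1 ∨ (2 : Eis) ∣ om * (om * z) - 1 := by
    rw [norm_eq] at h
    simp only [two_dvd_iff]
    simp [om]
    have e : (z.re ^ 2 - z.re * z.im + z.im ^ 2) % 2 =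
      ((z.re % 2) ^ 2 - (z.re % 2) * (z.im % 2) + (z.im % 2) ^ 2) % 2 := by
        simp [pow_two, Int.add_emod, Int.sub_emod, Int.mul_emod]
    rw [e] at h
    rcases Int.emod_two_eq z.re with h1 | h1 <;> rcases Int.emod_two_eq z.im with h2 | h2 <;>
      rw [h1, h2] at h <;> omega
  rcases H with H | H | H
  · exact ⟨_, rfl, rfl, H⟩
  · exact ⟨_, by rw [map_mul, norm_om, one_mul], by rw [map_mul, residue_om, one_mul], H⟩
  · exact ⟨_, by rw [map_mul, map_mul, norm_om, one_mul, one_mul],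
      by rw [map_mul, map_mul, residue_om, one_mul, one_mul], H⟩

lemma two_dvd_of_norm_even {z : Eis} (h : QuadraticAlgebra.norm z % 2 = 0) : (2 : Eis) ∣ z := by
  rw [norm_eq] at h
  rw [two_dvd_iff]
  have e : (z.re ^ 2 - z.re * z.im + z.im ^ 2) % 2 =
    ((z.re % 2) ^ 2 - (z.re % 2) * (z.im % 2) + (z.im % 2) ^ 2) % 2 := by
      simp [pow_two, Int.add_emod, Int.sub_emod, Int.mul_emod]
  rw [e] at h
  rcases Int.emod_two_eq z.re with h1 | h1 <;> rcases Int.emod_two_eq z.im with h2 | h2 <;>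
    rw [h1, h2] at h <;> omega

/-- The primary units are the powers of `ω`. -/
lemma IsPrimary.residue_eq_one_of_norm_eq_one {z : Eis} (h : IsPrimary z)
    (h1 : QuadraticAlgebra.norm z = 1) : residue z = 1 := by
  obtain ⟨y, hy, hr, k, hk⟩ := h.exists_four_dvd_sub_one
  rw [h1, norm_eq] at hy
  rw [← hr]
  have hre := congrArg re hk
  have him := congrArg im hk
  simp at hre him
  have hi : y.im = 0 := by
    have : y.im ^ 2 < 2 ^ 2 := by nlinarith [sq_nonneg (2 * y.re - y.im)]
    have := abs_lt_of_sq_lt_sq this (by norm_num)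
    rw [abs_lt] at this
    omega
  have hr1 : y.re = 1 := by
    rw [hi] at hy
    have : (y.re - 1) * (y.re + 1) = 0 := by linarith
    rcases mul_eq_zero.1 this with h | h <;> omega
  simp [residue_apply, hi, hr1]

end Eis

/-! ### Sums of two squares over `ℤ[ω]` and a reciprocity law -/

namespace Eis

open QuadraticAlgebra

/-- The ring `ℤ[ω]` contains no square root of `-1`. -/
lemma eq_zero_of_sq_add_sq_eq_zero {a b : Eis} (h : a ^ 2 + b ^ 2 = 0) : a = 0 ∧ b = 0 := by
  have hre := congrArg re h
  have him := congrArg im h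
  simp [pow_two] at hre him
  set M := a.im ^ 2 + b.im ^ 2 with hM
  -- The vectors of the real and of the imaginary parts span a plane lattice of irrational
  -- covolume, unless they vanish.
  have hD : (2 * (a.re * b.im - a.im * b.re)) ^ 2 = 3 * M ^ 2 := by
    have h1 : a.re ^ 2 + b.re ^ 2 = M := by rw [hM]; linarith
    have h2 : 2 * (a.re * a.im + b.re * b.im) = M := by rw [hM]; linarith
    calc (2 * (a.re * b.im - a.im * b.re)) ^ 2
        = 4 * (a.re ^ 2 + b.re ^ 2) * (a.im ^ 2 + b.im ^ 2)
          - (2 * (a.re * a.im + b.re * b.im)) ^ 2 := by ring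
      _ = 3 * M ^ 2 := by rw [h1, h2, ← hM]; ring
  have hM0 : M = 0 := by
    by_contra hne
    have hq : ((M : ℚ)) ≠ 0 := by exact_mod_cast hne
    have hsq : IsSquare (3 : ℚ) := by
      refine ⟨(2 * (a.re * b.im - a.im * b.re) : ℤ) / (M : ℚ), ?_⟩
      field_simp
      exact_mod_cast hD.symm
    have : IsSquare ((3 : ℕ) : ℚ) := by exact_mod_cast hsq
    rw [Rat.isSquare_natCast_iff] at this
    obtain ⟨r, hr⟩ := this
    have : r < 2 := by nlinarith
    interval_cases r <;> omega
  have h3 : a.im = 0 := by nlinarith [sq_nonneg a.im, sq_nonneg b.im]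
  have h4 : b.im = 0 := by nlinarith [sq_nonneg a.im, sq_nonneg b.im]
  rw [h3, h4] at hre
  have h5 : a.re = 0 := by nlinarith [sq_nonneg a.re, sq_nonneg b.re]
  have h6 : b.re = 0 := by nlinarith [sq_nonneg a.re, sq_nonneg b.re]
  exact ⟨by ext <;> simp [h3, h5], by ext <;> simp [h4, h6]⟩

/-- The triangle inequality `|a² + b²| ≤ |a|² + |b|²`. -/
lemma norm_sq_add_sq_le (a b : Eis) :
    QuadraticAlgebra.norm (a ^ 2 + b ^ 2) ≤
      (QuadraticAlgebra.norm a + QuadraticAlgebra.norm b) ^ 2 := by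
  have : (QuadraticAlgebra.norm a + QuadraticAlgebra.norm b) ^ 2
      - QuadraticAlgebra.norm (a ^ 2 + b ^ 2) = 3 * (a.re * b.im - a.im * b.re) ^ 2 := by
    simp only [norm_eq, pow_two, re_add, im_add, re_mul, im_mul]
    ring
  nlinarith [sq_nonneg (a.re * b.im - a.im * b.re)]

/-- Fermat's descent for sums of two squares, over the Eisenstein integers. -/
lemma exists_sq_add_sq_eq_unit_mul {p : ℕ} {x : Eis} (hp : p.Prime)
    (hx : QuadraticAlgebra.norm x = p) (k : Eis) (a b : Eis) (hk : k ≠ 0)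
    (hkp : QuadraticAlgebra.norm k < p) (h : a ^ 2 + b ^ 2 = k * x) :
    ∃ c d u : Eis, QuadraticAlgebra.norm u = 1 ∧ c ^ 2 + d ^ 2 = u * x := by
  induction hn : (QuadraticAlgebra.norm k).natAbs using Nat.strong_induction_on
    generalizing k a b with
  | _ n ih =>
  have hk0 := norm_pos hk
  by_cases hk1 : QuadraticAlgebra.norm k = 1
  · exact ⟨a, b, k, hk1, h⟩
  obtain ⟨q, hq⟩ := exists_three_mul_norm_sub_le a hk
  obtain ⟨r, hr⟩ := exists_three_mul_norm_sub_le b hk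
  set a' := a - k * q with ha'
  set b' := b - k * r with hb'
  -- The remainders satisfy `a'² + b'² = k l`.
  set l := x - 2 * a * q - 2 * b * r + k * (q ^ 2 + r ^ 2) with hl
  have hkl : a' ^ 2 + b' ^ 2 = k * l := by
    rw [ha', hb', hl]; linear_combination h
  by_cases hl0 : l = 0
  · exfalso
    rw [hl0, mul_zero] at hkl
    obtain ⟨h1, h2⟩ := eq_zero_of_sq_add_sq_eq_zero hkl
    have hxk : x = k * (q ^ 2 + r ^ 2) := by
      apply mul_left_cancel₀ hk
      rw [← h, sub_eq_zero.1 h1, sub_eq_zero.1 h2]; ring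
    have hd : QuadraticAlgebra.norm k ∣ (p : ℤ) := by
      rw [← hx, hxk, map_mul]; exact dvd_mul_right _ _
    have := (Nat.dvd_prime hp).1 (Int.natAbs_dvd_natAbs.2 hd)
    omega
  · have hlk : QuadraticAlgebra.norm l < QuadraticAlgebra.norm k := by
      have h1 := norm_sq_add_sq_le a' b'
      rw [hkl, map_mul] at h1
      have h2 := norm_nonneg a'
      have h3 := norm_nonneg b'
      by_contra! hcon
      nlinarith
    have hln := norm_pos hl0
    refine ih (QuadraticAlgebra.norm l).natAbs (by omega) l (x - a * q - b * r) (b * q - a * r) hl0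
      (by omega) ?_ rfl
    apply mul_left_cancel₀ (pow_ne_zero 2 hk)
    calc k ^ 2 * ((x - a * q - b * r) ^ 2 + (b * q - a * r) ^ 2)
        = (k * x - k * (a * q + b * r)) ^ 2 + (k * (b * q - a * r)) ^ 2 := by ring
      _ = (a ^ 2 + b ^ 2) * (a' ^ 2 + b' ^ 2) := by rw [← h, ha', hb']; ring
      _ = k ^ 2 * (l * x) := by rw [h, hkl]; ring

lemma pow_three_eq_one_or_neg_one {u : Eis} (h : QuadraticAlgebra.norm u = 1) :
    u ^ 3 = 1 ∨ u ^ 3 = -1 := by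
  rw [norm_eq] at h
  have h1 := abs_lt_of_sq_lt_sq (show u.re ^ 2 < 2 ^ 2 by nlinarith [sq_nonneg (2 * u.im - u.re)])
    (by norm_num)
  have h2 := abs_lt_of_sq_lt_sq (show u.im ^ 2 < 2 ^ 2 by nlinarith [sq_nonneg (2 * u.re - u.im)])
    (by norm_num)
  rw [abs_lt] at h1 h2
  obtain ⟨r, s⟩ := u
  obtain ⟨h1, h1'⟩ := h1
  obtain ⟨h2, h2'⟩ := h2
  simp only at *
  interval_cases r <;> interval_cases s <;> first | omega | decide

/-- Every element of `ℤ[ω]` of norm a prime `p ≡ 1 mod 4` is, up to sign, a sum of two squares: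
it splits in `ℤ[ω][i]`. -/
lemma exists_sq_add_sq_eq_or_neg {p : ℕ} {x : Eis} (hp : p.Prime) (h4 : p % 4 = 1)
    (hx : QuadraticAlgebra.norm x = p) :
    ∃ c d : Eis, c ^ 2 + d ^ 2 = x ∨ c ^ 2 + d ^ 2 = -x := by
  suffices H : ∃ c d u : Eis, QuadraticAlgebra.norm u = 1 ∧ c ^ 2 + d ^ 2 = u * x by
    obtain ⟨c, d, u, hu, h⟩ := H
    refine ⟨u * c, u * d, ?_⟩
    have e : (u * c) ^ 2 + (u * d) ^ 2 = u ^ 3 * x := by linear_combination u ^ 2 * h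
    rcases pow_three_eq_one_or_neg_one hu with h3 | h3 <;> rw [h3] at e
    · left; linear_combination e
    · right; linear_combination e
  have := Fact.mk hp
  obtain ⟨y, hy⟩ := ZMod.exists_sq_eq_neg_one_iff.2 (show p % 4 ≠ 3 by omega)
  obtain ⟨h, rfl⟩ := ZMod.intCast_surjective y
  have hdvd : (p : ℤ) ∣ h ^ 2 + 1 := by
    rw [← ZMod.intCast_zmod_eq_zero_iff_dvd]; push_cast; linear_combination -hy
  have hx0 : x ≠ 0 := by
    rintro rfl
    rw [QuadraticAlgebra.norm_zero] at hx
    exact hp.ne_zero (by exact_mod_cast hx.symm)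
  obtain ⟨q, hq⟩ := exists_three_mul_norm_sub_le (h : Eis) hx0
  obtain ⟨k, hk⟩ : x ∣ ((h : Eis) - x * q) ^ 2 + 1 ^ 2 := by
    have h1 : x ∣ (h : Eis) ^ 2 + 1 := by
      obtain ⟨m, hm⟩ := hdvd
      have hxs := algebraMap_norm_eq_mul_star x
      rw [hx] at hxs
      refine ⟨star x * m, ?_⟩
      rw [← mul_assoc, ← hxs]
      have := congrArg (Int.cast : ℤ → Eis) hm
      push_cast at this
      simpa using this
    have : ((h : Eis) - x * q) ^ 2 + 1 ^ 2 = ((h : Eis) ^ 2 + 1) + x * (x * q ^ 2 - 2 * h * q) := by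
      ring
    rw [this]
    exact dvd_add h1 (dvd_mul_right _ _)
  have hk0 : k ≠ 0 := by
    rintro rfl
    rw [mul_zero] at hk
    exact one_ne_zero (eq_zero_of_sq_add_sq_eq_zero hk).2
  refine exists_sq_add_sq_eq_unit_mul hp hx k _ 1 hk0 ?_ (by rw [hk, mul_comm])
  have h1 := norm_sq_add_sq_le ((h : Eis) - x * q) 1
  rw [hk, map_mul, hx, QuadraticAlgebra.norm_one] at h1
  rw [hx] at hq
  have h2 := norm_nonneg ((h : Eis) - x * q)
  have h3 := hp.two_le
  by_contra! hcon
  nlinarith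

/-- The two norms of `c + d i` from `ℤ[ω][i]` to the quadratic subrings `ℤ[ω]` and `ℤ[i]` have the
same norm over `ℤ`. -/
lemma norm_sq_add_sq (c d : Eis) : QuadraticAlgebra.norm (c ^ 2 + d ^ 2) =
    (QuadraticAlgebra.norm c - QuadraticAlgebra.norm d) ^ 2 +
      (2 * c.re * d.re - c.re * d.im - c.im * d.re + 2 * c.im * d.im) ^ 2 := by
  simp only [norm_eq, pow_two, re_add, im_add, re_mul, im_mul]
  ring

lemma three_dvd_iff (n : ℤ) : (3 : ℤ) ∣ n ↔ (n : ZMod 3) = 0 :=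
  (ZMod.intCast_zmod_eq_zero_iff_dvd n 3).symm

/-- The reciprocity law behind the set `primesP1`: for a primary `x` of prime norm
`p = a² + b² ≡ 1 mod 12` with `a` odd, the residue of `x` modulo `√-3` tells which one of `a` and
`b` is a multiple of `3`. The norms of `c + d i` to `ℤ[ω]` and to `ℤ[i]` are `±x` and `a + b i`, so
that the claim can be read off from `c` and `d` modulo `12`. -/
lemma IsPrimary.exists_eq_sq_add_sq {p : ℕ} {x : Eis} (hp : p.Prime) (h12 : p % 12 = 1)
    (hx : QuadraticAlgebra.norm x = p) (hxp : IsPrimary x) :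
    ∃ a b : ℤ, (p : ℤ) = a ^ 2 + b ^ 2 ∧ a % 2 = 1 ∧ b % 2 = 0 ∧
      (residue x = -1 → (3 : ℤ) ∣ a) ∧ (residue x = 1 → (3 : ℤ) ∣ b) := by
  obtain ⟨c, d, hcd⟩ := exists_sq_add_sq_eq_or_neg hp (by omega) hx
  have hpn := norm_sq_add_sq c d
  set a := QuadraticAlgebra.norm c - QuadraticAlgebra.norm d with ha
  set b := 2 * c.re * d.re - c.re * d.im - c.im * d.re + 2 * c.im * d.im with hb
  have hpab : (p : ℤ) = a ^ 2 + b ^ 2 := by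
    rw [← hpn, ← hx]
    rcases hcd with h | h <;> rw [h]
    rw [QuadraticAlgebra.norm_neg]
  have ha3 : (a : ZMod 3) = residue c ^ 2 - residue d ^ 2 := by
    rw [ha, Int.cast_sub, norm_cast_zmod_three, norm_cast_zmod_three]
  have hb3 : (b : ZMod 3) = 2 * residue c * residue d := by
    rw [hb, residue_apply, residue_apply]; push_cast
    linear_combination (-c.re * d.im - c.im * d.re : ZMod 3) * (by decide : (3 : ZMod 3) = 0)
  have h3a : ∀ r s : ZMod 3, r ^ 2 + s ^ 2 = -1 → r ^ 2 - s ^ 2 = 0 := by decide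
  have h3b : ∀ r s : ZMod 3, r ^ 2 + s ^ 2 = 1 → 2 * r * s = 0 := by decide
  have h2 (n : ℤ) : (n % 2 = 1 ↔ 2 * (n : ZMod 4) = 2) ∧ (n % 2 = 0 ↔ 2 * (n : ZMod 4) = 0) := by
    have h0 := emod_four_eq_iff (2 * n) 0
    have h2 := emod_four_eq_iff (2 * n) 2
    push_cast at h0 h2
    rw [← h0, ← h2]
    omega
  rcases hcd with h | h
  · refine ⟨a, b, hpab, ?_⟩
    have hr : residue x = residue c ^ 2 + residue d ^ 2 := by rw [← h]; simp
    rw [three_dvd_iff, three_dvd_iff, ha3, hb3, hr, ← and_assoc]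
    refine ⟨?_, h3a _ _, h3b _ _⟩
    rw [(h2 a).1, (h2 b).2, ha, hb, norm_eq, norm_eq]
    rw [IsPrimary, ← h, four_dvd_iff] at hxp
    simp [pow_succ] at hxp
    push_cast
    generalize (c.re : ZMod 4) = r at *
    generalize (c.im : ZMod 4) = s at *
    generalize (d.re : ZMod 4) = t at *
    generalize (d.im : ZMod 4) = u at *
    clear * - hxp
    revert r s t u; decide
  · have h' : x = -(c ^ 2 + d ^ 2) := by rw [h, neg_neg]
    refine ⟨b, a, by rw [hpab, add_comm], ?_⟩
    have hr : residue x = -(residue c ^ 2 + residue d ^ 2) := by rw [h']; simp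
    rw [three_dvd_iff, three_dvd_iff, ha3, hb3, hr, ← and_assoc]
    refine ⟨?_, fun H => h3b _ _ (neg_inj.1 H), fun H => h3a _ _ (by rw [← H, neg_neg])⟩
    rw [(h2 b).1, (h2 a).2, ha, hb, norm_eq, norm_eq]
    rw [IsPrimary, h', four_dvd_iff] at hxp
    simp [pow_succ] at hxp
    push_cast
    generalize (c.re : ZMod 4) = r at *
    generalize (c.im : ZMod 4) = s at *
    generalize (d.re : ZMod 4) = t at *
    generalize (d.im : ZMod 4) = u at *
    clear * - hxp
    revert r s t u; decide

/-- The representation of a prime as the sum of an odd and an even square is unique. -/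
lemma sq_eq_sq_of_prime_eq_sq_add_sq {p : ℕ} (hp : p.Prime) {a b x y : ℤ}
    (h : (p : ℤ) = a ^ 2 + b ^ 2) (h' : (p : ℤ) = x ^ 2 + y ^ 2) (ha : a % 2 = 1) (hb : b % 2 = 0)
    (hx : x % 2 = 1) (hy : y % 2 = 0) : x ^ 2 = a ^ 2 := by
  have hp0 : (0 : ℤ) < p := by exact_mod_cast hp.pos
  have key : ∀ y : ℤ, (p : ℤ) = x ^ 2 + y ^ 2 → y % 2 = 0 → (p : ℤ) ∣ x * a - y * b →
      x ^ 2 = a ^ 2 := by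
    intro y h' hy ⟨m, hm⟩
    have hm0 : m ≠ 0 := by
      rintro rfl
      have h1 : (x * a - y * b) % 2 = 1 := by
        simp [Int.sub_emod, Int.mul_emod, ha, hb, hx, hy]
      rw [hm] at h1
      simp at h1
    have h1 : (x * a - y * b) ^ 2 + (x * b + y * a) ^ 2 = (p : ℤ) ^ 2 := by
      calc (x * a - y * b) ^ 2 + (x * b + y * a) ^ 2 = (x ^ 2 + y ^ 2) * (a ^ 2 + b ^ 2) := by ring
        _ = (p : ℤ) ^ 2 := by rw [← h, ← h']; ring
    have h2 : (p : ℤ) ^ 2 ≤ (x * a - y * b) ^ 2 := by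
      have : 1 ≤ m ^ 2 := by have := pow_pos (abs_pos.2 hm0) 2; rw [sq_abs] at this; omega
      rw [hm, mul_pow]
      nlinarith [sq_nonneg (p : ℤ)]
    have h3 : x * b + y * a = 0 := by
      have : (x * b + y * a) ^ 2 = 0 := le_antisymm (by linarith) (sq_nonneg _)
      exact pow_eq_zero_iff two_ne_zero |>.1 this
    apply mul_left_cancel₀ hp0.ne'
    calc (p : ℤ) * x ^ 2 = x ^ 2 * a ^ 2 + (x * b) ^ 2 := by rw [h]; ring
      _ = x ^ 2 * a ^ 2 + (y * a) ^ 2 := by rw [eq_neg_of_add_eq_zero_left h3]; ring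
      _ = p * a ^ 2 := by rw [h']; ring
  have hdvd : (p : ℤ) ∣ (x * a - y * b) * (x * a - -y * b) := by
    refine ⟨x ^ 2 + a ^ 2 - p, ?_⟩
    have hb2 : b ^ 2 = p - a ^ 2 := by rw [h]; ring
    have hy2 : y ^ 2 = p - x ^ 2 := by rw [h']; ring
    calc (x * a - y * b) * (x * a - -y * b) = x ^ 2 * a ^ 2 - y ^ 2 * b ^ 2 := by ring
      _ = p * (x ^ 2 + a ^ 2 - p) := by rw [hb2, hy2]; ring
  rcases (Nat.prime_iff_prime_int.1 hp).dvd_or_dvd hdvd with h1 | h1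
  · exact key y h' hy h1
  · exact key (-y) (by rw [h']; ring) (by omega) h1

end Eis

/-! ### Admissible factors as norms -/

namespace Eis

open QuadraticAlgebra

lemma residue_eq_one_or_neg_one {x : Eis} (h : QuadraticAlgebra.norm x % 3 = 1) :
    residue x = 1 ∨ residue x = -1 := by
  have h1 : ((QuadraticAlgebra.norm x : ℤ) : ZMod 3) = (1 : ℤ) :=
    (ZMod.intCast_eq_intCast_iff' _ _ 3).2 h
  rw [norm_cast_zmod_three] at h1
  push_cast at h1
  generalize residue x = r at *
  revert r; decide

lemma norm_emod_three (x : Eis) :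
    QuadraticAlgebra.norm x % 3 = 0 ∧ residue x = 0 ∨
      QuadraticAlgebra.norm x % 3 = 1 ∧ residue x ≠ 0 := by
  have h0 := ZMod.intCast_eq_intCast_iff' (QuadraticAlgebra.norm x) 0 3
  have h1 := ZMod.intCast_eq_intCast_iff' (QuadraticAlgebra.norm x) 1 3
  rw [norm_cast_zmod_three] at h0 h1
  push_cast at h0 h1
  norm_num at h0 h1
  rw [← Int.dvd_iff_emod_eq_zero, ← h0, ← h1]
  generalize residue x = r at *
  clear h0 h1
  revert r; decide

/-- One half of the reciprocity law for `primesP1`. -/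
lemma mem_primesP1_of_isPrimary {p : ℕ} {x : Eis} (hp : p.Prime) (h12 : p % 12 = 1)
    (hx : QuadraticAlgebra.norm x = p) (hxp : IsPrimary x) (hr : residue x = -1) :
    p ∈ primesP1 := by
  obtain ⟨a, b, hab, ha, hb, h3, -⟩ := hxp.exists_eq_sq_add_sq hp h12 hx
  obtain ⟨t, ht⟩ := h3 hr
  have hb3 : b % 3 ≠ 0 := by
    intro h
    obtain ⟨s, hs⟩ := Int.dvd_of_emod_eq_zero h
    have : (p : ℤ) = 3 * (3 * (t ^ 2 + s ^ 2)) := by rw [hab, ht, hs]; ring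
    omega
  have hat : a = 6 * (t / 2) + 3 := by omega
  refine ⟨hp, h12, ?_⟩
  rcases (by omega : b % 3 = 2 ∨ b % 3 = 1) with h | h
  · exact ⟨b / 6, t / 2, by rw [hab, ← hat, ← (by omega : b = 6 * (b / 6) + 2), add_comm]⟩
  · exact ⟨(-b) / 6, t / 2, by
      rw [hab, ← hat, ← (by omega : -b = 6 * ((-b) / 6) + 2), neg_sq, add_comm]⟩

/-- The other half of the reciprocity law: it uses that `p` is a sum of two squares in one way
only. -/
lemma exists_isPrimary_of_mem_primesP1 {p : ℕ} (h : p ∈ primesP1) :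
    ∃ x : Eis, QuadraticAlgebra.norm x = p ∧ IsPrimary x ∧ residue x = -1 := by
  obtain ⟨hp, h12, k, t, hkt⟩ := h
  obtain ⟨y, hy⟩ := exists_norm_eq hp (by omega)
  obtain ⟨x, hx, hxp⟩ : ∃ x : Eis, QuadraticAlgebra.norm x = p ∧ IsPrimary x := by
    rcases isPrimary_or_neg (z := y) (by omega) with h | h
    · exact ⟨y, hy, h⟩
    · exact ⟨-y, by rw [QuadraticAlgebra.norm_neg, hy], h⟩
  refine ⟨x, hx, hxp, ?_⟩
  rcases residue_eq_one_or_neg_one (x := x) (by omega) with hr | hr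
  · exfalso
    obtain ⟨a, b, hab, ha, hb, -, h3⟩ := hxp.exists_eq_sq_add_sq hp h12 hx
    obtain ⟨s, hs⟩ := h3 hr
    have := sq_eq_sq_of_prime_eq_sq_add_sq (x := 6 * t + 3) (y := 6 * k + 2) hp hab
      (by rw [hkt, add_comm]) ha hb
      (by omega) (by omega)
    have h9 : (p : ℤ) = 3 * (3 * ((2 * t + 1) ^ 2 + s ^ 2)) := by rw [hab, ← this, hs]; ring
    omega
  · exact hr

lemma isPrimary_intCast {n : ℤ} (h : n % 4 = 1) : IsPrimary (n : Eis) := by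
  refine IsPrimary.congr (x := 1) (by simp [IsPrimary]) ⟨(n / 4 : ℤ), ?_⟩
  have : n = 4 * (n / 4) + 1 := by omega
  conv_lhs => rw [this]
  push_cast; ring

lemma isPrimary_natCast {n : ℕ} (h : n % 4 = 1) : IsPrimary (n : Eis) := by
  rw [← Int.cast_natCast]
  exact isPrimary_intCast (by omega)

/-- Each admissible factor is the norm of an element congruent to `1` modulo `4` and to `-1`
modulo `√-3`. -/
lemma exists_norm_eq_of_mem_admissibleFactors {k : ℕ} (hk : k ∈ admissibleFactors) :
    ∃ x : Eis, QuadraticAlgebra.norm x = k ∧ (4 : Eis) ∣ x - 1 ∧ residue x = -1 := by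
  suffices H : ∃ x : Eis, QuadraticAlgebra.norm x = k ∧ IsPrimary x ∧ residue x = -1 by
    obtain ⟨x, hx, hp, hr⟩ := H
    obtain ⟨y, hy, hyr, h4⟩ := hp.exists_four_dvd_sub_one
    exact ⟨y, hy.trans hx, h4, hyr.trans hr⟩
  rcases hk with h | ⟨p, hp, h5, rfl⟩ | ⟨p, q, hp, hp7, hq, hq7, rfl⟩
  · exact exists_isPrimary_of_mem_primesP1 h
  · refine ⟨p, by simp, ?_, ?_⟩
    · exact isPrimary_natCast (by omega)
    · rw [map_natCast, show (-1 : ZMod 3) = (2 : ℕ) from rfl, ZMod.natCast_eq_natCast_iff']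
      omega
  · obtain ⟨x, hx⟩ := exists_norm_eq hp (by omega)
    obtain ⟨y, hy⟩ := exists_norm_eq hq (by omega)
    have hxy : QuadraticAlgebra.norm (x * y) = (p * q : ℕ) := by
      rw [map_mul, hx, hy]; push_cast; rfl
    -- Conjugating `x` exchanges the two possible residues of the primary associates of `x * y`.
    obtain ⟨z, hz, hzy⟩ : ∃ z : Eis, QuadraticAlgebra.norm z = p ∧ IsPrimary (z * y) := by
      rcases isPrimary_or_neg (z := x * y) (by
        rw [map_mul, hx, hy, Int.mul_emod]; have : (p : ℤ) % 4 = 3 := by omega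
        have : (q : ℤ) % 4 = 3 := by omega
        simp [*]) with h | h
      · exact ⟨x, hx, h⟩
      · exact ⟨-x, by rw [QuadraticAlgebra.norm_neg, hx], by rwa [neg_mul]⟩
    have hnz : QuadraticAlgebra.norm (z * y) = (p * q : ℕ) := by
      rw [map_mul, hz, hy]; push_cast; rfl
    rcases residue_eq_one_or_neg_one (x := z * y) (by
        rw [map_mul, hz, hy, Int.mul_emod]; have : (p : ℤ) % 3 = 1 := by omega
        have : (q : ℤ) % 3 = 1 := by omega
        simp [*]) with h | h
    · refine ⟨-(star z * y), ?_, hzy.neg_star_mul (by omega), ?_⟩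
      · rw [QuadraticAlgebra.norm_neg, map_mul, QuadraticAlgebra.norm_star, hz, hy]; push_cast; rfl
      · rw [map_neg, map_mul, residue_star, ← map_mul, h]
    · exact ⟨z * y, hnz, hzy, h⟩

lemma emod_twelve_of_mul {a m : ℤ} (h2 : a * m % 2 = 1) (h3 : a * m % 3 ≠ 0) :
    a % 12 = 1 ∨ a % 12 = 5 ∨ a % 12 = 7 ∨ a % 12 = 11 := by
  have h2' : a % 2 ≠ 0 := fun h => by simp [Int.mul_emod, h] at h2
  have h3' : a % 3 ≠ 0 := fun h => by simp [Int.mul_emod, h] at h3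
  omega

/-- A norm `≡ 7 mod 12` has a prime factor `≡ 7 mod 12`, as the primes `≡ 2 mod 3` divide it to an
even power. -/
lemma exists_prime_dvd_norm {z : Eis} (h : QuadraticAlgebra.norm z % 12 = 7) :
    ∃ p : ℕ, p.Prime ∧ p % 12 = 7 ∧ (p : ℤ) ∣ QuadraticAlgebra.norm z := by
  induction hn : (QuadraticAlgebra.norm z).natAbs using Nat.strong_induction_on
    generalizing z with
  | _ n ih =>
  obtain ⟨q, hq, hqn⟩ := Nat.exists_prime_and_dvd (show n ≠ 1 by omega)
  have hqz : (q : ℤ) ∣ QuadraticAlgebra.norm z := by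
    rw [← hn] at hqn; exact Int.natCast_dvd.2 hqn
  have hq2 : (2 : ℤ) ≤ q := by exact_mod_cast hq.two_le
  have hq12 : (q : ℤ) % 12 = 1 ∨ (q : ℤ) % 12 = 5 ∨ (q : ℤ) % 12 = 7 ∨ (q : ℤ) % 12 = 11 := by
    obtain ⟨m, hm⟩ := hqz
    exact emod_twelve_of_mul (m := m) (by omega) (by omega)
  suffices H : ∃ y : Eis, QuadraticAlgebra.norm y % 12 = 7 ∧
      QuadraticAlgebra.norm y ∣ QuadraticAlgebra.norm z ∧
      QuadraticAlgebra.norm y < QuadraticAlgebra.norm z ∨ q % 12 = 7 by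
    obtain ⟨y, ⟨hy, hyz, hlt⟩ | hq7⟩ := H
    · have hy0 := norm_nonneg y
      obtain ⟨p, hp, hp7, hpy⟩ := ih (QuadraticAlgebra.norm y).natAbs (by omega) hy rfl
      exact ⟨p, hp, hp7, hpy.trans hyz⟩
    · exact ⟨q, hq, hq7, hqz⟩
  rcases dvd_or_exists_norm_eq hq hqz with ⟨y, rfl⟩ | ⟨x, hx, y, rfl⟩
  · refine ⟨y, Or.inl ?_⟩
    have hy0 := norm_nonneg y
    rw [map_mul, QuadraticAlgebra.norm_natCast] at *
    have hq1 : ((q : ℤ) ^ 2) % 12 = 1 := by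
      rcases hq12 with h | h | h | h <;> simp [pow_two, Int.mul_emod, h]
    have hy : QuadraticAlgebra.norm y % 12 = 7 := by
      rw [Int.mul_emod, hq1] at h; omega
    have : 0 < QuadraticAlgebra.norm y := by omega
    exact ⟨hy, dvd_mul_left _ _, lt_mul_of_one_lt_left this (by nlinarith)⟩
  · refine ⟨y, ?_⟩
    have hy0 := norm_nonneg y
    have h3 := norm_emod_three x
    rw [hx] at h3
    rw [map_mul, hx] at *
    rcases (by omega : (q : ℤ) % 12 = 1 ∨ q % 12 = 7) with hq1 | hq7
    · left
      have hy : QuadraticAlgebra.norm y % 12 = 7 := by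
        rw [Int.mul_emod, hq1] at h; omega
      have : 0 < QuadraticAlgebra.norm y := by omega
      exact ⟨hy, dvd_mul_left _ _, by nlinarith⟩
    · exact Or.inr hq7

/-- A primary element congruent to `-1` modulo `√-3` has an admissible factor in its norm:
otherwise it is a product of primary elements congruent to `1`. -/
lemma IsPrimary.exists_admissible_dvd_norm {z : Eis} (hz : IsPrimary z) (hr : residue z = -1) :
    ∃ k ∈ admissibleFactors, (k : ℤ) ∣ QuadraticAlgebra.norm z := by
  induction hn : (QuadraticAlgebra.norm z).natAbs using Nat.strong_induction_on
    generalizing z with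
  | _ n ih =>
  have hz4 := hz.norm_emod_four
  have hz3 : QuadraticAlgebra.norm z % 3 = 1 := by
    rcases norm_emod_three z with h | h
    · rw [hr] at h; exact absurd h.2 (by decide)
    · exact h.1
  have hz0 := norm_nonneg z
  by_cases hz1 : QuadraticAlgebra.norm z = 1
  · have := hz.residue_eq_one_of_norm_eq_one hz1
    rw [hr] at this
    exact absurd this (by decide)
  have step : ∀ u y : Eis, z = u * y → IsPrimary u → residue u = 1 →
      1 < QuadraticAlgebra.norm u →
      ∃ k ∈ admissibleFactors, (k : ℤ) ∣ QuadraticAlgebra.norm z := by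
    rintro u y rfl hu hur hu1
    rw [map_mul] at *
    have hy0 := norm_nonneg y
    have hy1 : 0 < QuadraticAlgebra.norm y := by
      rcases hy0.lt_or_eq with h | h
      · exact h
      · rw [← h] at hz4; simp at hz4
    rw [hur, one_mul] at hr
    obtain ⟨k, hk, hky⟩ := ih (QuadraticAlgebra.norm y).natAbs (by
      have : QuadraticAlgebra.norm y < QuadraticAlgebra.norm u * QuadraticAlgebra.norm y := by
        nlinarith
      omega) (hu.of_mul hz) hr rfl
    exact ⟨k, hk, hky.mul_left _⟩
  obtain ⟨q, hq, hqn⟩ := Nat.exists_prime_and_dvd (show n ≠ 1 by omega)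
  have hqz : (q : ℤ) ∣ QuadraticAlgebra.norm z := by
    rw [← hn] at hqn; exact Int.natCast_dvd.2 hqn
  have hq2 : (2 : ℤ) ≤ q := by exact_mod_cast hq.two_le
  have hq12 : (q : ℤ) % 12 = 1 ∨ (q : ℤ) % 12 = 5 ∨ (q : ℤ) % 12 = 7 ∨ (q : ℤ) % 12 = 11 := by
    obtain ⟨m, hm⟩ := hqz
    exact emod_twelve_of_mul (m := m) (by omega) (by omega)
  rcases dvd_or_exists_norm_eq hq hqz with ⟨y, rfl⟩ | ⟨x, hx, y, rfl⟩
  · have hdvd : (q : ℤ) ^ 2 ∣ QuadraticAlgebra.norm (q * y : Eis) := by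
      rw [map_mul, QuadraticAlgebra.norm_natCast]; exact dvd_mul_right _ _
    rcases hq12 with h | h | h | h
    · refine step q y rfl (isPrimary_natCast (by omega)) ?_ ?_
      · rw [map_natCast, ← Nat.cast_one, ZMod.natCast_eq_natCast_iff']
        omega
      · rw [QuadraticAlgebra.norm_natCast]; nlinarith
    · exact ⟨q ^ 2, Or.inr (Or.inl ⟨q, hq, by omega, rfl⟩), by push_cast; exact hdvd⟩
    · exact ⟨q * q, Or.inr (Or.inr ⟨q, q, hq, by omega, hq, by omega, rfl⟩), by
        push_cast; rw [← pow_two]; exact hdvd⟩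
    · refine step ((-q : ℤ) : Eis) (-y) (by push_cast; ring) (isPrimary_intCast (by omega)) ?_ ?_
      · rw [map_intCast, ← Int.cast_one, ZMod.intCast_eq_intCast_iff']
        omega
      · rw [QuadraticAlgebra.norm_intCast, Int.cast_id, neg_sq]; nlinarith
  · have h3 := norm_emod_three x
    rw [hx] at h3
    rcases (by omega : (q : ℤ) % 12 = 1 ∨ q % 12 = 7) with hq1 | hq7
    · obtain ⟨x', y', hxy, hx', hxp⟩ : ∃ x' y' : Eis, x * y = x' * y' ∧
          QuadraticAlgebra.norm x' = q ∧ IsPrimary x' := by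
        rcases isPrimary_or_neg (z := x) (by omega) with h | h
        · exact ⟨x, y, rfl, hx, h⟩
        · exact ⟨-x, -y, by ring, by rw [QuadraticAlgebra.norm_neg, hx], h⟩
      rcases residue_eq_one_or_neg_one (x := x') (by omega) with hr' | hr'
      · exact step x' y' hxy hxp hr' (by omega)
      · exact ⟨q, Or.inl (mem_primesP1_of_isPrimary hq (by omega) hx' hxp hr'), hqz⟩
    · rw [map_mul, hx] at *
      have hy : QuadraticAlgebra.norm y % 12 = 7 := by
        have h1 : (q * QuadraticAlgebra.norm y) % 12 = 1 := by omega
        rw [Int.mul_emod, (by omega : (q : ℤ) % 12 = 7)] at h1; omega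
      obtain ⟨p, hp, hp7, hpy⟩ := exists_prime_dvd_norm hy
      exact ⟨q * p, Or.inr (Or.inr ⟨q, p, hq, hq7, hp, hp7, rfl⟩), by
        push_cast; exact mul_dvd_mul_left _ hpy⟩

end Eis

/-! ### Factorization of the group determinant -/

/-- The group determinant of the Klein four-group: the product of the four character sums. -/
def kleinDet {R : Type*} [CommRing R] (a b c d : R) : R :=
  (a + b + c + d) * (a + b - c - d) * (a - b + c - d) * (a - b - c + d)

lemma map_kleinDet {R S : Type*} [CommRing R] [CommRing S] (f : R →+* S) (a b c d : R) :
    f (kleinDet a b c d) = kleinDet (f a) (f b) (f c) (f d) := by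
  simp [kleinDet]

namespace GroupDet

/-- `1 + ω = -ω²` is a primitive sixth root of unity. -/
def zeta : Eis := ⟨1, 1⟩

/-- The character of `ZMod 6` with values in `ℤ[ω]` that sends `1` to `1 + ω`. -/
def charSix : AddChar (ZMod 6) Eis := AddChar.zmodChar 6 (ζ := zeta) (by decide)

/-- The sign character of `ZMod 2`. -/
def charTwo : AddChar (ZMod 2) Eis := AddChar.zmodChar 2 (ζ := -1) (by decide)

/-- The pairing of `ZMod 6 × ZMod 2` with itself that identifies the group with its dual. -/
def pairing (g j : ZMod 6 × ZMod 2) : Eis := charSix (g.1 * j.1) * charTwo (g.2 * j.2)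

lemma pairing_add (g h j : ZMod 6 × ZMod 2) :
    pairing (g + h) j = pairing g j * pairing h j := by
  simp only [pairing, Prod.fst_add, Prod.snd_add, add_mul, AddChar.map_add_eq_mul]
  ring

lemma star_pairing (g j : ZMod 6 × ZMod 2) : star (pairing g j) = pairing g (-j) := by
  have h6 : ∀ a : ZMod 6, star (charSix a) = charSix (-a) := by decide
  have h2 : ∀ a : ZMod 2, star (charTwo a) = charTwo (-a) := by decide
  simp only [pairing, star_mul', h6, h2, Prod.fst_neg, Prod.snd_neg, mul_neg]

lemma sum_pairing (g : ZMod 6 × ZMod 2) :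
    ∑ j, pairing g j = if g = 0 then 12 else 0 := by
  have h6 : ∀ a : ZMod 6, ∑ j, charSix (a * j) = if a = 0 then 6 else 0 := by decide
  have h2 : ∀ a : ZMod 2, ∑ j, charTwo (a * j) = if a = 0 then 2 else 0 := by decide
  rw [Fintype.sum_prod_type]
  simp only [pairing, ← Finset.mul_sum, ← Finset.sum_mul, h6, h2, Prod.ext_iff]
  split_ifs <;> simp_all
  norm_num

/-- The eigenvalue of the group matrix that belongs to the character `pairing · j`. -/
def eigenvalue (x : ZMod 6 × ZMod 2 → ℤ) (j : ZMod 6 × ZMod 2) : Eis :=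
  ∑ k, (x k : Eis) * pairing (-k) j

/-- Dedekind's factorization of the group determinant. -/
lemma groupDeterminant_eq_prod (x : ZMod 6 × ZMod 2 → ℤ) :
    (groupDeterminant x : Eis) = ∏ j, eigenvalue x j := by
  let M : Matrix (ZMod 6 × ZMod 2) (ZMod 6 × ZMod 2) Eis := Matrix.of fun g h => (x (g - h) : Eis)
  let P : Matrix (ZMod 6 × ZMod 2) (ZMod 6 × ZMod 2) Eis := Matrix.of pairing
  let P' : Matrix (ZMod 6 × ZMod 2) (ZMod 6 × ZMod 2) Eis :=
    Matrix.of fun j g => pairing (-g) j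
  have hM : (groupDeterminant x : Eis) = M.det := by
    rw [groupDeterminant, ← eq_intCast (Int.castRingHom Eis), RingHom.map_det]
    rfl
  have hMP : M * P = P * Matrix.diagonal (eigenvalue x) := by
    ext1 g j
    rw [Matrix.mul_diagonal, Matrix.mul_apply, eigenvalue, Finset.mul_sum,
      ← Equiv.sum_comp (Equiv.subLeft g)]
    refine Finset.sum_congr rfl fun k _ => ?_
    simp only [M, P, Matrix.of_apply, Equiv.subLeft_apply, sub_sub_cancel]
    rw [sub_eq_add_neg, pairing_add]
    ring
  have hPP : P * P' = (12 : Eis) • 1 := by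
    ext1 g h
    simp only [Matrix.mul_apply, P, P', Matrix.of_apply, ← pairing_add, sum_pairing,
      Matrix.smul_apply, Matrix.one_apply, ← sub_eq_add_neg, sub_eq_zero]
    split_ifs <;> simp
  have hP : P.det ≠ 0 := by
    intro h
    have := congrArg Matrix.det hPP
    rw [Matrix.det_mul, h, zero_mul, Matrix.det_smul, Matrix.det_one, mul_one] at this
    exact pow_ne_zero _ (by decide) this.symm
  have := congrArg Matrix.det hMP
  rw [Matrix.det_mul, Matrix.det_mul, Matrix.det_diagonal, mul_comm] at this
  rw [hM]
  exact mul_left_cancel₀ hP this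

lemma eigenvalue_neg (x : ZMod 6 × ZMod 2 → ℤ) (j : ZMod 6 × ZMod 2) :
    eigenvalue x (-j) = star (eigenvalue x j) := by
  simp [eigenvalue, star_pairing]

lemma mul_eigenvalue_neg (x : ZMod 6 × ZMod 2 → ℤ) (j : ZMod 6 × ZMod 2) :
    eigenvalue x j * eigenvalue x (-j) = (QuadraticAlgebra.norm (eigenvalue x j) : ℤ) := by
  rw [eigenvalue_neg, ← QuadraticAlgebra.algebraMap_norm_eq_mul_star]; rfl

lemma eigenvalue_eq (x : ZMod 6 × ZMod 2 → ℤ) (i : ZMod 6) (j : ZMod 2) :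
    eigenvalue x (i, j) =
      (x (0, 0) * charSix 0 + x (1, 0) * charSix (-i) + x (2, 0) * charSix (-2 * i) +
        x (3, 0) * charSix (-3 * i) + x (4, 0) * charSix (-4 * i) + x (5, 0) * charSix (-5 * i)) +
      (x (0, 1) * charSix 0 + x (1, 1) * charSix (-i) + x (2, 1) * charSix (-2 * i) +
        x (3, 1) * charSix (-3 * i) + x (4, 1) * charSix (-4 * i) + x (5, 1) * charSix (-5 * i)) *
        charTwo j := by
  have e (f : ZMod 6 → Eis) : ∑ i, f i = f 0 + f 1 + f 2 + f 3 + f 4 + f 5 := Fin.sum_univ_six f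
  have e' (f : ZMod 2 → Eis) : ∑ i, f i = f 0 + f 1 := Fin.sum_univ_two f
  have h2 : charTwo (-j) = charTwo j := by revert j; decide
  simp only [eigenvalue, Fintype.sum_prod_type, e, e', pairing, Prod.fst_neg, Prod.snd_neg,
    neg_zero, zero_mul, neg_mul, one_mul, AddChar.map_zero_eq_one, h2, mul_one]
  ring

/-- The group determinant of `ZMod 6 × ZMod 2`, seen as `ZMod 3` times the Klein four-group: each
of the four cosets of `⟨(2, 0)⟩` contributes the values of its part of `x` at the trivial and at a
nontrivial character of `ZMod 3`. -/
theorem groupDeterminant_eq (x : ZMod 6 × ZMod 2 → ℤ) :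
    groupDeterminant x =
      kleinDet (x (0, 0) + x (4, 0) + x (2, 0)) (x (3, 0) + x (1, 0) + x (5, 0))
        (x (0, 1) + x (4, 1) + x (2, 1)) (x (3, 1) + x (1, 1) + x (5, 1)) *
      QuadraticAlgebra.norm (kleinDet (R := Eis)
        ⟨x (0, 0) - x (2, 0), x (4, 0) - x (2, 0)⟩ ⟨x (3, 0) - x (5, 0), x (1, 0) - x (5, 0)⟩
        ⟨x (0, 1) - x (2, 1), x (4, 1) - x (2, 1)⟩
        ⟨x (3, 1) - x (5, 1), x (1, 1) - x (5, 1)⟩) := by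
  have H : (groupDeterminant x : Eis) = ((kleinDet (x (0, 0) + x (4, 0) + x (2, 0))
      (x (3, 0) + x (1, 0) + x (5, 0)) (x (0, 1) + x (4, 1) + x (2, 1))
      (x (3, 1) + x (1, 1) + x (5, 1)) *
      QuadraticAlgebra.norm (kleinDet (R := Eis)
        ⟨x (0, 0) - x (2, 0), x (4, 0) - x (2, 0)⟩ ⟨x (3, 0) - x (5, 0), x (1, 0) - x (5, 0)⟩
        ⟨x (0, 1) - x (2, 1), x (4, 1) - x (2, 1)⟩
        ⟨x (3, 1) - x (5, 1), x (1, 1) - x (5, 1)⟩) : ℤ) : Eis) := by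
    rw [groupDeterminant_eq_prod, Fintype.prod_prod_type]
    have e (f : ZMod 6 → Eis) : ∏ i, f i = f 0 * f 1 * f 2 * f 3 * f 4 * f 5 := Fin.prod_univ_six f
    have e' (f : ZMod 2 → Eis) : ∏ i, f i = f 0 * f 1 := Fin.prod_univ_two f
    have h10 := mul_eigenvalue_neg x (1, 0)
    have h11 := mul_eigenvalue_neg x (1, 1)
    have h40 := mul_eigenvalue_neg x (4, 0)
    have h41 := mul_eigenvalue_neg x (4, 1)
    rw [show (-(1, 0) : ZMod 6 × ZMod 2) = (5, 0) from rfl] at h10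
    rw [show (-(1, 1) : ZMod 6 × ZMod 2) = (5, 1) from rfl] at h11
    rw [show (-(4, 0) : ZMod 6 × ZMod 2) = (2, 0) from rfl] at h40
    rw [show (-(4, 1) : ZMod 6 × ZMod 2) = (2, 1) from rfl] at h41
    have c0 : charTwo 0 = 1 ∧ charTwo 1 = -1 ∧ charSix 0 = 1 := by decide
    have c3 : charSix (-3) = -1 ∧ charSix (-2 * 3) = 1 ∧ charSix (-3 * 3) = -1 ∧
      charSix (-4 * 3) = 1 ∧ charSix (-5 * 3) = -1 := by decide
    have c1 : charSix (-1) = ⟨0, -1⟩ ∧ charSix (-2 * 1) = ⟨-1, -1⟩ ∧ charSix (-3 * 1) = ⟨-1, 0⟩ ∧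
      charSix (-4 * 1) = ⟨0, 1⟩ ∧ charSix (-5 * 1) = ⟨1, 1⟩ := by decide
    have c4 : charSix (-4) = ⟨0, 1⟩ ∧ charSix (-2 * 4) = ⟨-1, -1⟩ ∧ charSix (-3 * 4) = 1 ∧
      charSix (-4 * 4) = ⟨0, 1⟩ ∧ charSix (-5 * 4) = ⟨-1, -1⟩ := by decide
    set α : Eis := ⟨x (0, 0) - x (2, 0), x (4, 0) - x (2, 0)⟩ with hα
    set β : Eis := ⟨x (3, 0) - x (5, 0), x (1, 0) - x (5, 0)⟩ with hβ
    set γ : Eis := ⟨x (0, 1) - x (2, 1), x (4, 1) - x (2, 1)⟩ with hγ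
    set δ : Eis := ⟨x (3, 1) - x (5, 1), x (1, 1) - x (5, 1)⟩ with hδ
    have v40 : eigenvalue x (4, 0) = α + β + γ + δ := by
      simp only [eigenvalue_eq, c0, c4, hα, hβ, hγ, hδ]
      ext <;> simp <;> ring
    have v41 : eigenvalue x (4, 1) = α + β - γ - δ := by
      simp only [eigenvalue_eq, c0, c4, hα, hβ, hγ, hδ]
      ext <;> simp <;> ring
    have v10 : eigenvalue x (1, 0) = α - β + γ - δ := by
      simp only [eigenvalue_eq, c0, c1, hα, hβ, hγ, hδ]
      ext <;> simp <;> ring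
    have v11 : eigenvalue x (1, 1) = α - β - γ + δ := by
      simp only [eigenvalue_eq, c0, c1, hα, hβ, hγ, hδ]
      ext <;> simp <;> ring
    rw [v10] at h10
    rw [v11] at h11
    rw [v40] at h40
    rw [v41] at h41
    have hnorm : ((QuadraticAlgebra.norm (kleinDet α β γ δ) : ℤ) : Eis) =
        ((α + β + γ + δ) * eigenvalue x (2, 0)) * ((α + β - γ - δ) * eigenvalue x (2, 1)) *
        ((α - β + γ - δ) * eigenvalue x (5, 0)) * ((α - β - γ + δ) * eigenvalue x (5, 1)) := by
      rw [h10, h11, h40, h41, kleinDet, map_mul, map_mul, map_mul]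
      push_cast; ring
    set a := x (0, 0) + x (4, 0) + x (2, 0) with ha
    set b := x (3, 0) + x (1, 0) + x (5, 0) with hb
    set c := x (0, 1) + x (4, 1) + x (2, 1) with hc
    set d := x (3, 1) + x (1, 1) + x (5, 1) with hd
    have v00 : eigenvalue x (0, 0) = ((a + b + c + d : ℤ) : Eis) := by
      simp only [eigenvalue_eq, c0, ha, hb, hc, hd, neg_zero, mul_zero]
      push_cast; ring
    have v01 : eigenvalue x (0, 1) = ((a + b - c - d : ℤ) : Eis) := by
      simp only [eigenvalue_eq, c0, ha, hb, hc, hd, neg_zero, mul_zero]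
      push_cast; ring
    have v30 : eigenvalue x (3, 0) = ((a - b + c - d : ℤ) : Eis) := by
      simp only [eigenvalue_eq, c0, c3, ha, hb, hc, hd]
      push_cast; ring
    have v31 : eigenvalue x (3, 1) = ((a - b - c + d : ℤ) : Eis) := by
      simp only [eigenvalue_eq, c0, c3, ha, hb, hc, hd]
      push_cast; ring
    rw [Int.cast_mul, hnorm]
    simp only [e, e', v10, v11, v40, v41, v00, v01, v30, v31, kleinDet, Int.cast_mul]
    generalize α + β + γ + δ = e1
    generalize α + β - γ - δ = e2
    generalize α - β + γ - δ = e3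
    generalize α - β - γ + δ = e4
    ring
  exact_mod_cast H

/-- The group determinants of `ZMod 6 × ZMod 2` are the products `kleinDet a b c d` times norm of
`kleinDet α β γ δ`, where the integers `a, b, c, d` and the Eisenstein integers `α, β, γ, δ` are
congruent modulo `√-3`, as `ℤ[ZMod 3]` consists of the pairs in `ℤ × ℤ[ω]` that are congruent
modulo `√-3`. -/
theorem mem_groupDeterminantSet_iff {n : ℤ} :
    n ∈ groupDeterminantSet (ZMod 6 × ZMod 2) ↔ ∃ (a b c d : ℤ) (α β γ δ : Eis),
      Eis.residue α = a ∧ Eis.residue β = b ∧ Eis.residue γ = c ∧ Eis.residue δ = d ∧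
      n = kleinDet a b c d * QuadraticAlgebra.norm (kleinDet α β γ δ) := by
  constructor
  · rintro ⟨x, rfl⟩
    refine ⟨_, _, _, _, _, _, _, _, ?_, ?_, ?_, ?_, groupDeterminant_eq x⟩ <;>
      rw [Eis.residue_eq_intCast_iff]
    exacts [⟨x (2, 0), by ring⟩, ⟨x (5, 0), by ring⟩, ⟨x (2, 1), by ring⟩, ⟨x (5, 1), by ring⟩]
  · rintro ⟨a, b, c, d, α, β, γ, δ, ha, hb, hc, hd, rfl⟩
    rw [Eis.residue_eq_intCast_iff] at ha hb hc hd
    obtain ⟨p, hp⟩ := ha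
    obtain ⟨q, hq⟩ := hb
    obtain ⟨r, hr⟩ := hc
    obtain ⟨s, hs⟩ := hd
    let y : Fin 6 → Fin 2 → ℤ := ![![α.re + p, γ.re + r], ![β.im + q, δ.im + s], ![p, r],
      ![β.re + q, δ.re + s], ![α.im + p, γ.im + r], ![q, s]]
    refine ⟨fun g => y g.1 g.2, ?_⟩
    have hab : a = α.re + p + (α.im + p) + p := by linarith
    have hbb : b = β.re + q + (β.im + q) + q := by linarith
    have hcb : c = γ.re + r + (γ.im + r) + r := by linarith
    have hdb : d = δ.re + s + (δ.im + s) + s := by linarith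
    have hα : α = ⟨α.re + p - p, α.im + p - p⟩ := by ext <;> simp
    have hβ : β = ⟨β.re + q - q, β.im + q - q⟩ := by ext <;> simp
    have hγ : γ = ⟨γ.re + r - r, γ.im + r - r⟩ := by ext <;> simp
    have hδ : δ = ⟨δ.re + s - s, δ.im + s - s⟩ := by ext <;> simp
    refine (groupDeterminant_eq _).trans ?_
    change kleinDet (α.re + p + (α.im + p) + p) (β.re + q + (β.im + q) + q)
      (γ.re + r + (γ.im + r) + r) (δ.re + s + (δ.im + s) + s) * QuadraticAlgebra.norm (kleinDet
        (R := Eis) ⟨α.re + p - p, α.im + p - p⟩ ⟨β.re + q - q, β.im + q - q⟩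
        ⟨γ.re + r - r, γ.im + r - r⟩ ⟨δ.re + s - s, δ.im + s - s⟩) = _
    rw [← hab, ← hbb, ← hcb, ← hdb, ← hα, ← hβ, ← hγ, ← hδ]

end GroupDet

/-! ### Determinants of the Klein four-group -/

open GroupDet

namespace KleinDet

/-- The four factors are `1 + 4k, 1, 1, 1`. -/
lemma kleinDet_one_add {R : Type*} [CommRing R] (k : R) :
    kleinDet (1 + k) k k k = 1 + 4 * k := by
  simp only [kleinDet]; ring

/-- The four factors are `2b₁, 2b₂, 2b₃, 2b₄`. -/
lemma kleinDet_of_sum {R : Type*} [CommRing R] {b₁ b₂ b₃ b₄ s : R}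
    (h : b₁ + b₂ + b₃ + b₄ = 2 * s) :
    kleinDet s (b₁ + b₂ - s) (b₁ + b₃ - s) (b₁ + b₄ - s) = 16 * (b₁ * b₂ * b₃ * b₄) := by
  have h1 : s + (b₁ + b₂ - s) + (b₁ + b₃ - s) + (b₁ + b₄ - s) = 2 * b₁ := by
    linear_combination h
  have h2 : s + (b₁ + b₂ - s) - (b₁ + b₃ - s) - (b₁ + b₄ - s) = 2 * b₂ := by
    linear_combination -h
  have h3 : s - (b₁ + b₂ - s) + (b₁ + b₃ - s) - (b₁ + b₄ - s) = 2 * b₃ := by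
    linear_combination -h
  have h4 : s - (b₁ + b₂ - s) - (b₁ + b₃ - s) + (b₁ + b₄ - s) = 2 * b₄ := by
    linear_combination -h
  rw [kleinDet, h1, h2, h3, h4]; ring

/-- `kleinDet a b c d` is a fourth power modulo `4`. -/
lemma kleinDet_eq_pow_four_add {R : Type*} [CommRing R] (a b c d : R) :
    ∃ e, kleinDet a b c d = (a + b + c + d) ^ 4 + 4 * e := by
  refine ⟨(a + b + c + d) * (-(a + b + c + d) ^ 2 * (b + c + d) +
    (a + b + c + d) * ((c + d) * (b + d) + (c + d) * (b + c) + (b + d) * (b + c)) -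
    2 * ((c + d) * (b + d) * (b + c))), ?_⟩
  rw [kleinDet]
  ring

/-- If `2` divides the sum, then all four factors are even, with halves that have an even sum. -/
lemma kleinDet_of_two_dvd {R : Type*} [CommRing R] {a b c d s : R} (h : a + b + c + d = 2 * s) :
    kleinDet a b c d = 16 * (s * (s - c - d) * (s - b - d) * (s - b - c)) := by
  have h2 : a + b - c - d = 2 * (s - c - d) := by linear_combination h
  have h3 : a - b + c - d = 2 * (s - b - d) := by linear_combination h
  have h4 : a - b - c + d = 2 * (s - b - c) := by linear_combination h
  rw [kleinDet, h, h2, h3, h4]; ring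

/-- The 2-adic shape of the group determinants of the Klein four-group. -/
def IsKleinShape (n : ℤ) : Prop := n % 4 = 1 ∨ n % 32 = 16 ∨ n % 64 = 0

lemma isKleinShape_kleinDet (a b c d : ℤ) : IsKleinShape (kleinDet a b c d) := by
  rcases Int.emod_two_eq (a + b + c + d) with h | h
  · obtain ⟨s, hs⟩ := Int.dvd_of_emod_eq_zero h
    rw [kleinDet_of_two_dvd hs]
    right
    have hsum : (s + (s - c - d) + (s - b - d) + (s - b - c)) % 2 = 0 := by omega
    generalize s - c - d = t at *
    generalize s - b - d = u at *
    generalize s - b - c = v at *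
    have H : (s * t * u * v) % 2 = 1 ∨ (s * t * u * v) % 4 = 0 := by
      have h4 : ∀ s t u v : ZMod 4, 2 * (s + t + u + v) = 0 →
          2 * (s * t * u * v) = 2 ∨ s * t * u * v = 0 := by decide
      have h0 := Eis.emod_four_eq_iff (2 * (s + t + u + v)) 0
      have h1 := Eis.emod_four_eq_iff (2 * (s * t * u * v)) 2
      have h2 := Eis.emod_four_eq_iff (s * t * u * v) 0
      have h3 := h4 s t u v
      push_cast at h0 h1 h2
      rw [← h0, ← h1, ← h2] at h3
      omega
    omega
  · obtain ⟨e, he⟩ := kleinDet_eq_pow_four_add a b c d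
    left
    rw [he]
    obtain ⟨q, hq⟩ : ∃ q, a + b + c + d = 2 * q + 1 := ⟨(a + b + c + d) / 2, by omega⟩
    rw [hq]
    ring_nf
    omega

/-- Over `ℤ[ω]`, the determinant is primary or divisible by `16`. -/
lemma isPrimary_kleinDet_or (α β γ δ : Eis) :
    Eis.IsPrimary (kleinDet α β γ δ) ∨ ∃ y : Eis, kleinDet α β γ δ = 16 * y := by
  rcases Int.emod_two_eq (QuadraticAlgebra.norm (α + β + γ + δ)) with h | h
  · obtain ⟨s, hs⟩ := Eis.two_dvd_of_norm_even h
    exact Or.inr ⟨_, kleinDet_of_two_dvd hs⟩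
  · obtain ⟨e, he⟩ := kleinDet_eq_pow_four_add α β γ δ
    exact Or.inl ((Eis.isPrimary_pow_four h).congr ⟨e, by rw [he]; ring⟩)

/-- The 2-adic shape of a norm from `ℤ[ω]`. -/
lemma norm_shape (y : Eis) : QuadraticAlgebra.norm y % 2 = 1 ∨
    (∃ z : Eis, QuadraticAlgebra.norm y = 4 * QuadraticAlgebra.norm z) := by
  rcases Int.emod_two_eq (QuadraticAlgebra.norm y) with h | h
  · obtain ⟨s, hs⟩ := Eis.two_dvd_of_norm_even h
    refine Or.inr ⟨s, ?_⟩
    have : QuadraticAlgebra.norm (2 : Eis) = 4 := by rw [Eis.norm_eq]; rfl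
    rw [hs, map_mul, this]
  · exact Or.inl h

/-- The properties of the pair `(a, x)` that restrict the group
determinants `a N(x)` of `ZMod 6 × ZMod 2`. -/
lemma exists_of_mem {n : ℤ} (hn : n ∈ groupDeterminantSet (ZMod 6 × ZMod 2)) :
    ∃ (a : ℤ) (x : Eis), n = a * QuadraticAlgebra.norm x ∧ Eis.residue x = a ∧ IsKleinShape a ∧
      (Eis.IsPrimary x ∨ ∃ y : Eis, x = 16 * y) := by
  obtain ⟨a, b, c, d, α, β, γ, δ, ha, hb, hc, hd, rfl⟩ := mem_groupDeterminantSet_iff.1 hn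
  refine ⟨_, _, rfl, ?_, isKleinShape_kleinDet a b c d, isPrimary_kleinDet_or α β γ δ⟩
  rw [map_kleinDet, ha, hb, hc, hd]
  exact (map_kleinDet (Int.castRingHom (ZMod 3)) a b c d).symm

/-! ### Realizing the listed integers -/

lemma three_eq_zero : (3 : ZMod 3) = 0 := by decide

/-- Every integer of Klein shape is a determinant of the Klein four-group whose last three factors
are congruent to `1` modulo `3`. -/
lemma exists_kleinDet_eq {n : ℤ} (h : IsKleinShape n) : ∃ a b c d : ℤ, kleinDet a b c d = n ∧
    (a : ZMod 3) = n ∧ (b : ZMod 3) = n - 1 ∧ (c : ZMod 3) = n - 1 ∧ (d : ZMod 3) = n - 1 := by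
  -- It is enough to give four integers with an even sum.
  have even : ∀ b₁ b₂ b₃ b₄ s : ℤ, b₁ + b₂ + b₃ + b₄ = 2 * s → 16 * (b₁ * b₂ * b₃ * b₄) = n →
      (b₁ : ZMod 3) = -n → (b₂ : ZMod 3) = -1 → (b₃ : ZMod 3) = -1 → (b₄ : ZMod 3) = -1 →
      ∃ a b c d : ℤ, kleinDet a b c d = n ∧ (a : ZMod 3) = n ∧ (b : ZMod 3) = n - 1 ∧
        (c : ZMod 3) = n - 1 ∧ (d : ZMod 3) = n - 1 := by
    intro b₁ b₂ b₃ b₄ s hs hn h1 h2 h3 h4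
    have hs' : (s : ZMod 3) = n := by
      have := congrArg (Int.cast : ℤ → ZMod 3) hs
      push_cast at this
      rw [h1, h2, h3, h4] at this
      linear_combination this + (s + 1 : ZMod 3) * three_eq_zero
    refine ⟨_, _, _, _, (kleinDet_of_sum hs).trans hn, hs', ?_, ?_, ?_⟩ <;> push_cast <;>
      simp only [hs', h1, h2, h3, h4] <;> linear_combination (-n : ZMod 3) * three_eq_zero
  rcases h with h | h | h
  · refine ⟨1 + n / 4, n / 4, n / 4, n / 4, ?_, ?_⟩
    · rw [kleinDet_one_add]; omega
    · have hn : n = 1 + 4 * (n / 4) := by omega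
      have hn' := congrArg (Int.cast : ℤ → ZMod 3) hn
      push_cast at hn' ⊢
      refine ⟨?_, ?_, ?_, ?_⟩ <;> rw [hn'] <;>
        linear_combination (-(n / 4 : ℤ) : ZMod 3) * three_eq_zero
  · obtain ⟨t, ht⟩ : ∃ t, n = 16 * (2 * t + 1) := ⟨n / 32, by omega⟩
    refine even (-(2 * t + 1)) (-1) (-1) (-1) (-t - 2) (by ring) (by rw [ht]; ring) ?_
      (by simp) (by simp) (by simp)
    rw [ht]; push_cast; linear_combination (5 * (2 * t + 1) : ZMod 3) * three_eq_zero
  · obtain ⟨t, ht⟩ : ∃ t, n = 64 * t := ⟨n / 64, by omega⟩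
    refine even (2 * t) 2 (-1) (-1) t (by ring) (by rw [ht]; ring) ?_
      (by decide) (by simp) (by simp)
    rw [ht]; push_cast; linear_combination (22 * t : ZMod 3) * three_eq_zero

/-- Some values of `kleinDet` over `ℤ[ω]` with the last three factors congruent to `1` modulo
`√-3`: elements `≡ 1 mod 4`, and even elements of a special form. -/
def IsEisShape (z : Eis) : Prop :=
  (4 : Eis) ∣ z - 1 ∨ (∃ y : Eis, (2 : Eis) ∣ y - 1 ∧ z = -16 * y) ∨ ∃ y : Eis, z = -32 * y

lemma exists_kleinDet_eis_eq {z : Eis} (h : IsEisShape z) :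
    ∃ α β γ δ : Eis, kleinDet α β γ δ = z ∧ Eis.residue α = Eis.residue z ∧
      Eis.residue β = Eis.residue z - 1 ∧ Eis.residue γ = Eis.residue z - 1 ∧
      Eis.residue δ = Eis.residue z - 1 := by
  have even : ∀ b₁ b₂ b₃ b₄ s : Eis, b₁ + b₂ + b₃ + b₄ = 2 * s → 16 * (b₁ * b₂ * b₃ * b₄) = z →
      Eis.residue b₁ = -Eis.residue z → Eis.residue b₂ = -1 → Eis.residue b₃ = -1 →
      Eis.residue b₄ = -1 →
      ∃ α β γ δ : Eis, kleinDet α β γ δ = z ∧ Eis.residue α = Eis.residue z ∧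
        Eis.residue β = Eis.residue z - 1 ∧ Eis.residue γ = Eis.residue z - 1 ∧
        Eis.residue δ = Eis.residue z - 1 := by
    intro b₁ b₂ b₃ b₄ s hs hn h1 h2 h3 h4
    have hs' : Eis.residue s = Eis.residue z := by
      have := congrArg Eis.residue hs
      simp only [map_add, map_mul, map_ofNat, h1, h2, h3, h4] at this
      linear_combination this + (Eis.residue s + 1 : ZMod 3) * three_eq_zero
    refine ⟨_, _, _, _, (kleinDet_of_sum hs).trans hn, hs', ?_, ?_, ?_⟩ <;>
      simp only [map_add, map_sub, hs', h1, h2, h3, h4] <;>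
      linear_combination (-Eis.residue z : ZMod 3) * three_eq_zero
  rcases h with ⟨k, hk⟩ | ⟨y, ⟨k, hk⟩, rfl⟩ | ⟨y, rfl⟩
  · obtain rfl : z = 1 + 4 * k := by rw [← hk]; ring
    refine ⟨1 + k, k, k, k, kleinDet_one_add k, ?_⟩
    simp only [map_add, map_mul, map_one, map_ofNat]
    refine ⟨?_, ?_, ?_, ?_⟩ <;> linear_combination (-Eis.residue k : ZMod 3) * three_eq_zero
  · refine even y (-1) (-1) (-1) (k - 1) (by linear_combination hk) (by ring) ?_
      (by simp) (by simp) (by simp)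
    simp only [map_neg, map_mul, map_ofNat]
    linear_combination (-5 * Eis.residue y : ZMod 3) * three_eq_zero
  · have hom : Eis.om ^ 2 + Eis.om + 1 = 0 := by decide
    refine even (2 * y) (-1) (-Eis.om) (-Eis.om ^ 2) y (by linear_combination -hom) ?_ ?_
      (by simp) (by simp [Eis.residue_om]) (by simp [Eis.residue_om])
    · linear_combination (-32 * y * (Eis.om - 1)) * hom
    · simp only [map_neg, map_mul, map_ofNat]
      linear_combination (-10 * Eis.residue y : ZMod 3) * three_eq_zero

/-- Determinants over `ℤ` and `ℤ[ω]` whose last three factors are congruent to `1` modulo `√-3` can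
be combined as soon as they are congruent: the entries are then congruent, too. -/
lemma mem_of_shape {n a : ℤ} {z : Eis} (ha : IsKleinShape a) (hz : IsEisShape z)
    (h : Eis.residue z = a) (hn : n = a * QuadraticAlgebra.norm z) :
    n ∈ groupDeterminantSet (ZMod 6 × ZMod 2) := by
  obtain ⟨a', b, c, d, habcd, h1, h2, h3, h4⟩ := exists_kleinDet_eq ha
  obtain ⟨α, β, γ, δ, hz, g1, g2, g3, g4⟩ := exists_kleinDet_eis_eq hz
  refine mem_groupDeterminantSet_iff.2 ⟨a', b, c, d, α, β, γ, δ, ?_, ?_, ?_, ?_, ?_⟩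
  · rw [g1, h1, h]
  · rw [g2, h2, h]
  · rw [g3, h3, h]
  · rw [g4, h4, h]
  · rw [hn, habcd, hz]

lemma intCast_zmod_three_eq (n m : ℤ) (h : n % 3 = m % 3) : (n : ZMod 3) = m :=
  (ZMod.intCast_eq_intCast_iff' n m 3).2 h

lemma norm_intCast_mul (k : ℤ) (y : Eis) :
    QuadraticAlgebra.norm ((k : Eis) * y) = k ^ 2 * QuadraticAlgebra.norm y := by
  rw [map_mul, QuadraticAlgebra.norm_intCast, Int.cast_id]

/-- The multiples of `3` of Klein shape, times the norm of `z`. -/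
lemma mem_of_residue_eq_zero {z : Eis} (hz : IsEisShape z) (h : Eis.residue z = 0) (m : ℤ) :
    3 * (4 * m - 1) * QuadraticAlgebra.norm z ∈ groupDeterminantSet (ZMod 6 × ZMod 2) ∧
    48 * (2 * m - 1) * QuadraticAlgebra.norm z ∈ groupDeterminantSet (ZMod 6 × ZMod 2) ∧
    192 * m * QuadraticAlgebra.norm z ∈ groupDeterminantSet (ZMod 6 × ZMod 2) := by
  refine ⟨mem_of_shape ?_ hz ?_ rfl, mem_of_shape ?_ hz ?_ rfl, mem_of_shape ?_ hz ?_ rfl⟩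
  · left; omega
  · rw [h, ← Int.cast_zero]; exact intCast_zmod_three_eq _ _ (by omega)
  · right; left; omega
  · rw [h, ← Int.cast_zero]; exact intCast_zmod_three_eq _ _ (by omega)
  · right; right; omega
  · rw [h, ← Int.cast_zero]; exact intCast_zmod_three_eq _ _ (by omega)

/-- The integers `≡ 2 mod 3` of Klein shape, times the norm of `z`. -/
lemma mem_of_residue_eq_neg_one {z : Eis} (hz : IsEisShape z) (h : Eis.residue z = -1) (m : ℤ) :
    (12 * m + 5) * QuadraticAlgebra.norm z ∈ groupDeterminantSet (ZMod 6 × ZMod 2) ∧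
    -16 * (6 * m + 1) * QuadraticAlgebra.norm z ∈ groupDeterminantSet (ZMod 6 × ZMod 2) ∧
    -64 * (3 * m + 1) * QuadraticAlgebra.norm z ∈ groupDeterminantSet (ZMod 6 × ZMod 2) := by
  have h1 : (-1 : ZMod 3) = (-1 : ℤ) := by simp
  refine ⟨mem_of_shape ?_ hz ?_ rfl, mem_of_shape ?_ hz ?_ rfl, mem_of_shape ?_ hz ?_ rfl⟩
  · left; omega
  · rw [h, h1]; exact intCast_zmod_three_eq _ _ (by omega)
  · right; left; omega
  · rw [h, h1]; exact intCast_zmod_three_eq _ _ (by omega)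
  · right; right; omega
  · rw [h, h1]; exact intCast_zmod_three_eq _ _ (by omega)

lemma norm_neg_sixteen_mul (y : Eis) :
    QuadraticAlgebra.norm (-16 * y) = 256 * QuadraticAlgebra.norm y := by
  have := norm_intCast_mul (-16) y
  push_cast at this
  rw [this]

lemma norm_neg_thirtyTwo_mul (y : Eis) :
    QuadraticAlgebra.norm (-32 * y) = 1024 * QuadraticAlgebra.norm y := by
  have := norm_intCast_mul (-32) y
  push_cast at this
  rw [this]

lemma formsA_subset : formsA ⊆ groupDeterminantSet (ZMod 6 × ZMod 2) := by
  rintro n ⟨m, h⟩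
  have hs : IsEisShape (-3) := Or.inl ⟨-1, by ring⟩
  obtain ⟨h1, h2, h3⟩ := mem_of_residue_eq_zero hs (by rw [map_neg, map_ofNat]; decide) m
  have hn : QuadraticAlgebra.norm (-3 : Eis) = 9 := by rw [Eis.norm_eq]; rfl
  rw [hn] at h1 h2 h3
  rcases h with h | h | h
  · convert h1 using 1; rw [h]; ring
  · convert h2 using 1; rw [h]; ring
  · convert h3 using 1; rw [h]; ring

lemma residue_sqrtNegThree : Eis.residue Eis.sqrtNegThree = 0 := by decide

lemma formsB_subset : formsB ⊆ groupDeterminantSet (ZMod 6 × ZMod 2) := by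
  rintro n ⟨m, h⟩
  have h16 : IsEisShape (-16 * Eis.sqrtNegThree) :=
    Or.inr (Or.inl ⟨_, ⟨Eis.om, by decide⟩, rfl⟩)
  have h32 : IsEisShape (-32 * Eis.sqrtNegThree) := Or.inr (Or.inr ⟨_, rfl⟩)
  obtain ⟨h1, h2, h3⟩ := mem_of_residue_eq_zero h16 (by
    rw [map_mul, residue_sqrtNegThree, mul_zero]) m
  obtain ⟨g1, -, -⟩ := mem_of_residue_eq_zero h32 (by
    rw [map_mul, residue_sqrtNegThree, mul_zero]) m
  rw [norm_neg_sixteen_mul, Eis.norm_sqrtNegThree] at h1 h2 h3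
  rw [norm_neg_thirtyTwo_mul, Eis.norm_sqrtNegThree] at g1
  rcases h with ⟨p, hp, hp7, h⟩ | h | h | h | h
  · obtain ⟨x, hx⟩ := Eis.exists_norm_eq hp (by omega)
    have hn : QuadraticAlgebra.norm (Eis.sqrtNegThree * x) = 3 * p := by
      rw [map_mul, Eis.norm_sqrtNegThree, hx]
    have hr : Eis.residue (Eis.sqrtNegThree * x) = 0 := by
      rw [map_mul, residue_sqrtNegThree, zero_mul]
    obtain ⟨y, hy, hyr, h4⟩ : ∃ y : Eis, QuadraticAlgebra.norm y = 3 * p ∧ Eis.residue y = 0 ∧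
        (4 : Eis) ∣ y - 1 := by
      rcases Eis.isPrimary_or_neg (z := Eis.sqrtNegThree * x) (by omega) with h | h
      · obtain ⟨y, h1, h2, h3⟩ := h.exists_four_dvd_sub_one
        exact ⟨y, h1.trans hn, h2.trans hr, h3⟩
      · obtain ⟨y, h1, h2, h3⟩ := h.exists_four_dvd_sub_one
        refine ⟨y, h1.trans ?_, h2.trans ?_, h3⟩
        · rw [QuadraticAlgebra.norm_neg, hn]
        · rw [map_neg, hr, neg_zero]
    obtain ⟨h1, h2, h3⟩ := mem_of_residue_eq_zero (Or.inl h4) hyr m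
    rw [hy] at h1 h2 h3
    rcases h with h | h | h
    · convert h1 using 1; rw [h]; ring
    · convert h2 using 1; rw [h]; ring
    · convert h3 using 1; rw [h]; ring
  · convert h1 using 1; rw [h]; ring
  · convert g1 using 1; rw [h]; ring
  · convert h2 using 1; rw [h]; ring
  · convert h3 using 1; rw [h]; ring

lemma formsC_subset : formsC ⊆ groupDeterminantSet (ZMod 6 × ZMod 2) := by
  rintro n ⟨m, h⟩
  -- Elements of norm `2⁸ N(x)` and `2¹⁰ N(x)`.
  have h8 : ∀ x : Eis, (2 : Eis) ∣ x - 1 → Eis.residue x = 1 →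
      IsEisShape (-16 * x) ∧ Eis.residue (-16 * x) = -1 := fun x h h1 =>
    ⟨Or.inr (Or.inl ⟨x, h, rfl⟩), by rw [map_mul, h1, map_neg, map_ofNat]; decide⟩
  have h10 : ∀ x : Eis, Eis.residue x = 1 →
      IsEisShape (-32 * -x) ∧ Eis.residue (-32 * -x) = -1 := fun x h1 =>
    ⟨Or.inr (Or.inr ⟨-x, rfl⟩), by rw [map_mul, map_neg, map_neg, h1, map_ofNat]; decide⟩
  rcases h with h | ⟨k, hk, h⟩ | h | ⟨p, hp, hp7, h⟩ | h
  · have h1 : IsEisShape 1 := Or.inl (by simp)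
    have hr : ∀ n : ℤ, n % 3 = 1 → Eis.residue 1 = n := fun n hn => by
      rw [map_one, ← Int.cast_one]; exact intCast_zmod_three_eq _ _ (by omega)
    have hn : n = n * QuadraticAlgebra.norm (1 : Eis) := by
      rw [QuadraticAlgebra.norm_one, mul_one]
    rcases h with h | h | h
    · exact mem_of_shape (Or.inl (by omega)) h1 (hr n (by omega)) hn
    · exact mem_of_shape (Or.inr (Or.inl (by omega))) h1 (hr n (by omega)) hn
    · exact mem_of_shape (Or.inr (Or.inr (by omega))) h1 (hr n (by omega)) hn
  · obtain ⟨x, hx, h4, hr⟩ := Eis.exists_norm_eq_of_mem_admissibleFactors hk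
    obtain ⟨h1, h2, h3⟩ := mem_of_residue_eq_neg_one (Or.inl h4) hr m
    rw [hx] at h1 h2 h3
    rcases h with h | h | h
    · rwa [h]
    · convert h2 using 1; rw [h]; ring
    · convert h3 using 1; rw [h]; ring
  · rcases h with h | h
    · obtain ⟨hs, hr⟩ := h8 1 (by simp) (map_one _)
      obtain ⟨h1, -, -⟩ := mem_of_residue_eq_neg_one hs hr m
      rw [norm_neg_sixteen_mul, QuadraticAlgebra.norm_one] at h1
      convert h1 using 1; rw [h]; ring
    · obtain ⟨hs, hr⟩ := h10 1 (map_one _)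
      obtain ⟨h1, -, -⟩ := mem_of_residue_eq_neg_one hs hr m
      rw [norm_neg_thirtyTwo_mul, QuadraticAlgebra.norm_neg, QuadraticAlgebra.norm_one] at h1
      convert h1 using 1; rw [h]; ring
  · obtain ⟨x, hx⟩ := Eis.exists_norm_eq hp (by omega)
    obtain ⟨y, hy, h2, hyr⟩ : ∃ y : Eis, QuadraticAlgebra.norm y = p ∧ (2 : Eis) ∣ y - 1 ∧
        Eis.residue y = 1 := by
      obtain ⟨y, hy, -, h2⟩ := Eis.exists_two_dvd_sub_one (z := x) (by omega)
      rcases Eis.residue_eq_one_or_neg_one (x := y) (by omega) with hr | hr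
      · exact ⟨y, hy.trans hx, h2, hr⟩
      · refine ⟨-y, by rw [QuadraticAlgebra.norm_neg, hy, hx], ?_, by rw [map_neg, hr, neg_neg]⟩
        obtain ⟨c, hc⟩ := h2
        exact ⟨-c - 1, by linear_combination -hc⟩
    rcases h with h | h
    · obtain ⟨hs, hr⟩ := h8 y h2 hyr
      obtain ⟨h1, -, -⟩ := mem_of_residue_eq_neg_one hs hr m
      rw [norm_neg_sixteen_mul, hy] at h1
      convert h1 using 1; rw [h]; ring
    · obtain ⟨hs, hr⟩ := h10 y hyr
      obtain ⟨h1, -, -⟩ := mem_of_residue_eq_neg_one hs hr m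
      rw [norm_neg_thirtyTwo_mul, QuadraticAlgebra.norm_neg, hy] at h1
      convert h1 using 1; rw [h]; ring
  · obtain ⟨hs, hr⟩ := h8 1 (by simp) (map_one _)
    obtain ⟨-, h2, h3⟩ := mem_of_residue_eq_neg_one hs hr m
    rw [norm_neg_sixteen_mul, QuadraticAlgebra.norm_one] at h2 h3
    rcases h with h | h
    · convert h2 using 1; rw [h]; ring
    · convert h3 using 1; rw [h]; ring

/-! ### The shape of a group determinant -/

lemma IsKleinShape.mul {a m : ℤ} (ha : IsKleinShape a) (hm : m % 4 = 1) :
    IsKleinShape (a * m) := by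
  obtain ⟨j, rfl⟩ : ∃ j, m = 4 * j + 1 := ⟨m / 4, by omega⟩
  rcases ha with h | h | h
  · obtain ⟨i, rfl⟩ : ∃ i, a = 4 * i + 1 := ⟨a / 4, by omega⟩
    left; ring_nf; omega
  · obtain ⟨i, rfl⟩ : ∃ i, a = 32 * i + 16 := ⟨a / 32, by omega⟩
    right; left; ring_nf; omega
  · obtain ⟨i, rfl⟩ : ∃ i, a = 64 * i := ⟨a / 64, by omega⟩
    right; right; ring_nf; omega

lemma emod_three_mul {a b : ℤ} (hb : b % 3 = 1) : (a * b) % 3 = a % 3 := by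
  rw [Int.mul_emod, hb, mul_one, Int.emod_emod_of_dvd _ (dvd_refl 3)]

lemma norm_sixteen_mul (y : Eis) :
    QuadraticAlgebra.norm (16 * y) = 256 * QuadraticAlgebra.norm y := by
  have := norm_intCast_mul 16 y
  push_cast at this
  rw [this]

lemma isKleinShape_of_mem {n : ℤ} (hn : n ∈ groupDeterminantSet (ZMod 6 × ZMod 2)) :
    IsKleinShape n := by
  obtain ⟨a, x, rfl, -, ha, hx | ⟨y, rfl⟩⟩ := exists_of_mem hn
  · exact ha.mul hx.norm_emod_four
  · right; right
    rw [norm_sixteen_mul]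
    have : a * (256 * QuadraticAlgebra.norm y) = 64 * (4 * (a * QuadraticAlgebra.norm y)) := by
      ring
    omega

/-- As `N(x) ≡ a² mod 3`, either both or none of `a` and `N(x)` are multiples of `3`. -/
lemma residue_dichotomy {a : ℤ} {x : Eis} (h : Eis.residue x = a) :
    (a % 3 = 0 ∧ Eis.residue x = 0) ∨
      (a % 3 ≠ 0 ∧ QuadraticAlgebra.norm x % 3 = 1 ∧ (a % 3 = 2 → Eis.residue x = -1)) := by
  have h0 := ZMod.intCast_eq_intCast_iff' a 0 3
  have h2 := ZMod.intCast_eq_intCast_iff' a (-1) 3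
  rw [← h] at h0 h2
  push_cast at h0 h2
  rcases Eis.norm_emod_three x with ⟨h3, hr⟩ | ⟨h3, hr⟩
  · exact Or.inl ⟨by have := h0.1 hr; omega, hr⟩
  · refine Or.inr ⟨fun h' => hr (h0.2 (by omega)), h3, fun h' => h2.2 (by omega)⟩

/-- The 2-adic shape of a group determinant `a N(16 y)` with `a` even. -/
lemma emod_of_even {a : ℤ} (y : Eis) (ha : a % 32 = 16 ∨ a % 64 = 0) :
    (a * (256 * QuadraticAlgebra.norm y)) % 8192 = 4096 ∨
      (a * (256 * QuadraticAlgebra.norm y)) % 16384 = 0 := by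
  obtain ⟨b, rfl⟩ : ∃ b, a = 16 * b := ⟨a / 16, by omega⟩
  have e : 16 * b * (256 * QuadraticAlgebra.norm y) = 4096 * (b * QuadraticAlgebra.norm y) := by
    ring
  rw [e]
  suffices H : (b * QuadraticAlgebra.norm y) % 2 = 1 ∨ (b * QuadraticAlgebra.norm y) % 4 = 0 by
    omega
  rcases norm_shape y with h | ⟨z, h⟩
  · rcases ha with ha | ha
    · left; rw [Int.mul_emod, h, (by omega : b % 2 = 1)]; rfl
    · right; rw [Int.mul_emod, (by omega : b % 4 = 0)]; simp
  · right
    rw [h, mul_left_comm]; simp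

lemma emod_twelve_of_dvd {p m : ℤ} {r : ℤ} (hp : p % 12 = 7) (h : (p * m) % 12 = (7 * r) % 12) :
    m % 12 = r % 12 := by
  rw [Int.mul_emod, hp] at h; omega

lemma emod_twelve_of_mem_admissibleFactors {k : ℕ} (hk : k ∈ admissibleFactors) :
    (k : ℤ) % 12 = 1 := by
  rcases hk with h | ⟨p, hp, h5, rfl⟩ | ⟨p, q, hp, hp7, hq, hq7, rfl⟩
  · have := h.2.1; omega
  · push_cast; rw [pow_two, Int.mul_emod, (by omega : (p : ℤ) % 12 = 5)]; rfl
  · push_cast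
    rw [Int.mul_emod, (by omega : (p : ℤ) % 12 = 7), (by omega : (q : ℤ) % 12 = 7)]; rfl

lemma mem_formsA {n : ℤ} (hn : IsKleinShape n) (h : (3 : ℤ) ^ 3 ∣ n) : n ∈ formsA := by
  obtain ⟨t, rfl⟩ := h
  rcases hn with h | h | h
  · exact ⟨(t + 1) / 4, Or.inl (by omega)⟩
  · exact ⟨(t / 16 + 1) / 2, Or.inr (Or.inl (by omega))⟩
  · exact ⟨t / 64, Or.inr (Or.inr (by omega))⟩

/-- Group determinants `≡ 1 mod 3` are listed by their 2-adic shape; those `≡ 2 mod 3` need an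
admissible factor of `N(x)` if `x` is primary, and an analysis of `N(y)` if `x = 16 y`. -/
lemma mem_formsC {n : ℤ} (hn : n ∈ groupDeterminantSet (ZMod 6 × ZMod 2)) (h : ¬ (3 : ℤ) ∣ n) :
    n ∈ formsC := by
  have hs := isKleinShape_of_mem hn
  rcases (by omega : n % 3 = 1 ∨ n % 3 = 2) with h3 | h3
  · rcases hs with h | h | h
    · exact ⟨n / 12, Or.inl (Or.inl (by omega))⟩
    · exact ⟨n / 16 / 6, Or.inl (Or.inr (Or.inl (by omega)))⟩
    · exact ⟨n / 64 / 3, Or.inl (Or.inr (Or.inr (by omega)))⟩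
  obtain ⟨a, x, rfl, hr, ha, hx⟩ := exists_of_mem hn
  rcases residue_dichotomy hr with ⟨h0, -⟩ | ⟨h0, hN, h2⟩
  · exact absurd (Dvd.dvd.mul_right (Int.dvd_of_emod_eq_zero h0) _) h
  have ha3 : a % 3 = 2 := by rwa [emod_three_mul hN] at h3
  rcases hx with hx | ⟨y, rfl⟩
  · obtain ⟨k, hk, m, hm⟩ := hx.exists_admissible_dvd_norm (h2 ha3)
    have hk12 := emod_twelve_of_mem_admissibleFactors hk
    have hN4 := hx.norm_emod_four
    have hm12 : m % 12 = 1 := by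
      have h1 : (k * m : ℤ) % 12 = 1 := by rw [← hm]; omega
      rw [Int.mul_emod, hk12] at h1; omega
    have hts := ha.mul (show m % 4 = 1 by omega)
    have ht3 : (a * m) % 3 = 2 := by rw [emod_three_mul (by omega), ha3]
    have ht : a * QuadraticAlgebra.norm x = (a * m) * k := by rw [hm]; ring
    rw [ht]
    generalize a * m = t at *
    rcases hts with h | h | h
    · refine ⟨t / 12, Or.inr (Or.inl ⟨k, hk, Or.inl ?_⟩)⟩
      rw [show 12 * (t / 12) + 5 = t by omega]
    · refine ⟨-t / 16 / 6, Or.inr (Or.inl ⟨k, hk, Or.inr (Or.inl ?_)⟩)⟩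
      rw [show -2 ^ 4 * (6 * (-t / 16 / 6) + 1) = t by omega]
    · refine ⟨-t / 64 / 3, Or.inr (Or.inl ⟨k, hk, Or.inr (Or.inr ?_)⟩)⟩
      rw [show -2 ^ 6 * (3 * (-t / 64 / 3) + 1) = t by omega]
  · rw [norm_sixteen_mul] at *
    have even : ∀ n : ℤ, n % 3 = 2 → n % 8192 = 4096 ∨ n % 16384 = 0 → n ∈ formsC := by
      intro n h3 h
      rcases h with h | h
      · exact ⟨-n / 4096 / 6, Or.inr (Or.inr (Or.inr (Or.inr (Or.inl (by omega)))))⟩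
      · exact ⟨-n / 16384 / 3, Or.inr (Or.inr (Or.inr (Or.inr (Or.inr (by omega)))))⟩
    rcases ha with ha | ha
    · -- An odd norm is `1` or `7` modulo `12`; in the second case it has a prime factor that is
      -- `7` modulo `12`.
      have odd : ∀ z : Eis, QuadraticAlgebra.norm z % 3 = 1 → QuadraticAlgebra.norm z % 2 = 1 →
          (∃ m, a * QuadraticAlgebra.norm z = 12 * m + 5) ∨
          ∃ p : ℕ, p.Prime ∧ p % 12 = 7 ∧ ∃ m, a * QuadraticAlgebra.norm z = (12 * m + 5) * p := by
        intro z h3 h2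
        rcases (by omega : QuadraticAlgebra.norm z % 12 = 1 ∨ QuadraticAlgebra.norm z % 12 = 7)
          with h | h
        · left
          have : (a * QuadraticAlgebra.norm z) % 12 = 5 := by
            rw [Int.mul_emod, h, (by omega : a % 12 = 5)]; rfl
          exact ⟨(a * QuadraticAlgebra.norm z) / 12, by omega⟩
        · right
          obtain ⟨p, hp, hp7, m, hm⟩ := Eis.exists_prime_dvd_norm h
          have hm1 : m % 12 = 1 := emod_twelve_of_dvd (r := 1) (by omega : (p : ℤ) % 12 = 7)
            (by rw [← hm, h]; rfl)
          have : (a * m) % 12 = 5 := by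
            rw [Int.mul_emod, hm1, (by omega : a % 12 = 5)]; rfl
          refine ⟨p, hp, hp7, a * m / 12, ?_⟩
          rw [show 12 * (a * m / 12) + 5 = a * m by omega, hm]; ring
      rcases norm_shape y with h2 | ⟨z, hz⟩
      · rcases odd y (by omega) h2 with ⟨m, hm⟩ | ⟨p, hp, hp7, m, hm⟩
        · exact ⟨m, Or.inr (Or.inr (Or.inl (Or.inl (by linear_combination 256 * hm))))⟩
        · exact ⟨m, Or.inr (Or.inr (Or.inr (Or.inl
            ⟨p, hp, hp7, Or.inl (by linear_combination 256 * hm)⟩)))⟩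
      rw [hz] at h3 hN ⊢
      rcases norm_shape z with h2 | ⟨w, hw⟩
      · rcases odd z (by omega) h2 with ⟨m, hm⟩ | ⟨p, hp, hp7, m, hm⟩
        · exact ⟨m, Or.inr (Or.inr (Or.inl (Or.inr (by linear_combination 1024 * hm))))⟩
        · exact ⟨m, Or.inr (Or.inr (Or.inr (Or.inl
            ⟨p, hp, hp7, Or.inr (by linear_combination 1024 * hm)⟩)))⟩
      rw [hw] at h3 hN ⊢
      apply even _ h3
      have e : a * (256 * (4 * (4 * QuadraticAlgebra.norm w))) =
          4096 * (a * QuadraticAlgebra.norm w) := by ring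
      rw [e]
      rcases norm_shape w with h2 | ⟨v, hv⟩
      · have : (a * QuadraticAlgebra.norm w) % 2 = 1 := by
          rw [Int.mul_emod, h2, (by omega : a % 2 = 1)]; rfl
        omega
      · rw [hv, mul_left_comm a]; omega
    · exact even _ h3 (emod_of_even y ha)

/-- Here `a = 3b` and `x` is `√-3` times an element prime to `3`, so that the norm of a primary `x`
is three times an integer `≡ 7 mod 12`. -/
lemma mem_formsB {n : ℤ} (hn : n ∈ groupDeterminantSet (ZMod 6 × ZMod 2)) (h3 : (3 : ℤ) ∣ n)
    (h27 : ¬ (3 : ℤ) ^ 3 ∣ n) : n ∈ formsB := by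
  obtain ⟨a, x, rfl, hr, ha, hx⟩ := exists_of_mem hn
  rcases residue_dichotomy hr with ⟨h0, hr0⟩ | ⟨h0, hN, -⟩
  swap
  · have := emod_three_mul (a := a) hN
    omega
  obtain ⟨b, rfl⟩ := Int.dvd_of_emod_eq_zero h0
  rcases hx with hx | ⟨y, rfl⟩
  · obtain ⟨z, rfl⟩ := Eis.exists_eq_sqrtNegThree_mul hr0
    have hN4 := hx.norm_emod_four
    rw [map_mul, Eis.norm_sqrtNegThree] at *
    have hz3 : QuadraticAlgebra.norm z % 3 = 1 := by
      rcases Eis.norm_emod_three z with h | h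
      · obtain ⟨c, hc⟩ := Int.dvd_of_emod_eq_zero h.1
        exact absurd ⟨b * c, by rw [hc]; ring⟩ h27
      · exact h.1
    obtain ⟨p, hp, hp7, m, hm⟩ := Eis.exists_prime_dvd_norm (z := z) (by omega)
    have hm1 : m % 12 = 1 := emod_twelve_of_dvd (r := 1) (by omega : (p : ℤ) % 12 = 7)
      (by rw [← hm]; omega)
    have hts := ha.mul (show m % 4 = 1 by omega)
    have ht : 3 * b * (3 * QuadraticAlgebra.norm z) = 9 * (b * m) * p := by rw [hm]; ring
    rw [ht]
    rw [mul_assoc 3 b m] at hts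
    generalize b * m = t at *
    rcases hts with h | h | h
    · refine ⟨(t + 1) / 4, Or.inl ⟨p, hp, hp7, Or.inl ?_⟩⟩
      rw [show 4 * ((t + 1) / 4) - 1 = t by omega]; norm_num
    · refine ⟨(t / 16 + 1) / 2, Or.inl ⟨p, hp, hp7, Or.inr (Or.inl ?_)⟩⟩
      rw [show 2 ^ 4 * 3 ^ 2 * (2 * ((t / 16 + 1) / 2) - 1) = 9 * t by omega]
    · refine ⟨t / 64, Or.inl ⟨p, hp, hp7, Or.inr (Or.inr ?_)⟩⟩
      rw [show 2 ^ 6 * 3 ^ 2 * (t / 64) = 9 * t by omega]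
  · have hy0 : Eis.residue y = 0 := by
      rw [map_mul, map_ofNat] at hr0
      exact (mul_eq_zero.1 hr0).resolve_left (by decide)
    obtain ⟨z, rfl⟩ := Eis.exists_eq_sqrtNegThree_mul hy0
    rw [norm_sixteen_mul] at *
    have even : ∀ n : ℤ, n % 9 = 0 → n % 8192 = 4096 ∨ n % 16384 = 0 → n ∈ formsB := by
      intro n h3 h
      rcases h with h | h
      · exact ⟨(n / 9 / 4096 + 1) / 2, Or.inr (Or.inr (Or.inr (Or.inl (by omega))))⟩
      · exact ⟨n / 9 / 16384, Or.inr (Or.inr (Or.inr (Or.inr (by omega))))⟩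
    have h9 : (3 * b * (256 * QuadraticAlgebra.norm (Eis.sqrtNegThree * z))) % 9 = 0 := by
      rw [map_mul, Eis.norm_sqrtNegThree]
      have e : 3 * b * (256 * (3 * QuadraticAlgebra.norm z)) =
        9 * (256 * (b * QuadraticAlgebra.norm z)) := by ring
      omega
    rcases ha with ha | ha
    · rw [map_mul, Eis.norm_sqrtNegThree] at *
      have hz3 : QuadraticAlgebra.norm z % 3 = 1 := by
        rcases Eis.norm_emod_three z with h | h
        · obtain ⟨c, hc⟩ := Int.dvd_of_emod_eq_zero h.1
          exact absurd ⟨256 * b * c, by rw [hc]; ring⟩ h27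
        · exact h.1
      have odd : ∀ z : Eis, QuadraticAlgebra.norm z % 3 = 1 → QuadraticAlgebra.norm z % 2 = 1 →
          (∃ m, b * QuadraticAlgebra.norm z = 4 * m - 1) ∨
          ∃ p : ℕ, p.Prime ∧ p % 12 = 7 ∧ ∃ m, b * QuadraticAlgebra.norm z = m * p := by
        intro z h3 h2
        rcases (by omega : QuadraticAlgebra.norm z % 4 = 1 ∨ QuadraticAlgebra.norm z % 12 = 7)
          with h | h
        · left
          have : (b * QuadraticAlgebra.norm z) % 4 = 3 := by
            rw [Int.mul_emod, h, (by omega : b % 4 = 3)]; rfl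
          exact ⟨(b * QuadraticAlgebra.norm z + 1) / 4, by omega⟩
        · right
          obtain ⟨p, hp, hp7, m, hm⟩ := Eis.exists_prime_dvd_norm h
          exact ⟨p, hp, hp7, b * m, by rw [hm]; ring⟩
      rcases norm_shape z with h2 | ⟨w, hw⟩
      · rcases odd z hz3 h2 with ⟨m, hm⟩ | ⟨p, hp, hp7, m, hm⟩
        · exact ⟨m, Or.inr (Or.inl (by linear_combination 2304 * hm))⟩
        · exact ⟨4 * m, Or.inl ⟨p, hp, hp7, Or.inr (Or.inr (by linear_combination 2304 * hm))⟩⟩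
      rw [hw] at hz3 h9 ⊢
      rcases norm_shape w with h2 | ⟨v, hv⟩
      · rcases odd w (by omega) h2 with ⟨m, hm⟩ | ⟨p, hp, hp7, m, hm⟩
        · exact ⟨m, Or.inr (Or.inr (Or.inl (by linear_combination 9216 * hm)))⟩
        · exact ⟨16 * m, Or.inl ⟨p, hp, hp7, Or.inr (Or.inr (by linear_combination 9216 * hm))⟩⟩
      rw [hv] at hz3 h9 ⊢
      apply even _ h9
      have e : 3 * b * (256 * (3 * (4 * (4 * QuadraticAlgebra.norm v)))) =
          4096 * (9 * (b * QuadraticAlgebra.norm v)) := by ring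
      rw [e]
      rcases norm_shape v with h2 | ⟨u, hu⟩
      · have : (b * QuadraticAlgebra.norm v) % 2 = 1 := by
          rw [Int.mul_emod, h2, (by omega : b % 2 = 1)]; rfl
        omega
      · rw [hu, mul_left_comm b]; omega
    · exact even _ h9 (emod_of_even _ ha)

/-- A group determinant that is divisible by `3` is divisible by `9`: if `3` divides a factor in
`ℤ`, then `√-3` divides the corresponding factor in `ℤ[ω]`. -/
lemma nine_dvd {n : ℤ} (hn : n ∈ groupDeterminantSet (ZMod 6 × ZMod 2)) (h3 : (3 : ℤ) ∣ n) :
    (3 : ℤ) ^ 2 ∣ n := by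
  obtain ⟨a, x, rfl, hr, -, -⟩ := exists_of_mem hn
  rcases residue_dichotomy hr with ⟨h0, hr0⟩ | ⟨h0, hN, -⟩
  · obtain ⟨b, rfl⟩ := Int.dvd_of_emod_eq_zero h0
    obtain ⟨z, rfl⟩ := Eis.exists_eq_sqrtNegThree_mul hr0
    exact ⟨b * QuadraticAlgebra.norm z, by rw [map_mul, Eis.norm_sqrtNegThree]; ring⟩
  · have := emod_three_mul (a := a) hN
    omega

lemma three_pow_dvd_of_mem_formsA {n : ℤ} (h : n ∈ formsA) : (3 : ℤ) ^ 3 ∣ n := by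
  obtain ⟨m, h | h | h⟩ := h <;> omega

lemma nine_dvd_of_mem_formsB {n : ℤ} (h : n ∈ formsB) : (3 : ℤ) ^ 2 ∣ n := by
  obtain ⟨m, ⟨p, -, -, h⟩ | h⟩ := h
  · rcases h with rfl | rfl | rfl
    · exact ⟨(4 * m - 1) * p, by ring⟩
    · exact ⟨2 ^ 4 * (2 * m - 1) * p, by ring⟩
    · exact ⟨2 ^ 6 * m * p, by ring⟩
  · omega

lemma not_three_dvd_of_mem_formsC {n : ℤ} (h : n ∈ formsC) : ¬ (3 : ℤ) ∣ n := by
  obtain ⟨m, h | ⟨k, hk, h⟩ | h | ⟨p, -, hp7, h⟩ | h⟩ := h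
  · omega
  · have hk3 : (k : ℤ) % 3 = 1 := by have := emod_twelve_of_mem_admissibleFactors hk; omega
    rcases h with rfl | rfl | rfl
    · have := emod_three_mul (a := 12 * m + 5) hk3; omega
    · have := emod_three_mul (a := -2 ^ 4 * (6 * m + 1)) hk3; omega
    · have := emod_three_mul (a := -2 ^ 6 * (3 * m + 1)) hk3; omega
  · omega
  · have hp3 : (p : ℤ) % 3 = 1 := by omega
    rcases h with rfl | rfl
    · have := emod_three_mul (a := 2 ^ 8 * (12 * m + 5)) hp3; omega
    · have := emod_three_mul (a := 2 ^ 10 * (12 * m + 5)) hp3; omega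
  · omega

end KleinDet

open KleinDet

theorem theorem5p2 :
    groupDeterminantSet (ZMod 6 × ZMod 2) = formsA ∪ formsB ∪ formsC ∧
    {n ∈ groupDeterminantSet (ZMod 6 × ZMod 2) | (3 : ℤ) ^ 3 ∣ n} = formsA ∧
    {n ∈ groupDeterminantSet (ZMod 6 × ZMod 2) | (3 : ℤ) ^ 2 ∣ n ∧ ¬ (3 : ℤ) ^ 3 ∣ n} =
      {n ∈ formsB | ¬ (3 : ℤ) ^ 3 ∣ n} ∧
    {n ∈ groupDeterminantSet (ZMod 6 × ZMod 2) | ¬ (3 : ℤ) ∣ n} = formsC ∧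
    ∀ n ∈ groupDeterminantSet (ZMod 6 × ZMod 2), ¬ ((3 : ℤ) ∣ n ∧ ¬ (3 : ℤ) ^ 2 ∣ n) := by
  refine ⟨?_, ?_, ?_, ?_, fun n hn h => h.2 (nine_dvd hn h.1)⟩
  · refine Set.Subset.antisymm (fun n hn => ?_)
      (Set.union_subset (Set.union_subset formsA_subset formsB_subset) formsC_subset)
    by_cases h3 : (3 : ℤ) ∣ n
    · by_cases h27 : (3 : ℤ) ^ 3 ∣ n
      · exact Or.inl (Or.inl (mem_formsA (isKleinShape_of_mem hn) h27))
      · exact Or.inl (Or.inr (mem_formsB hn h3 h27))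
    · exact Or.inr (mem_formsC hn h3)
  · ext n
    exact ⟨fun h => mem_formsA (isKleinShape_of_mem h.1) h.2,
      fun h => ⟨formsA_subset h, three_pow_dvd_of_mem_formsA h⟩⟩
  · ext n
    exact ⟨fun h => ⟨mem_formsB h.1 (dvd_trans (by norm_num) h.2.1) h.2.2, h.2.2⟩,
      fun h => ⟨formsB_subset h.1, nine_dvd_of_mem_formsB h.1, h.2⟩⟩
  · ext n
    exact ⟨fun h => mem_formsC h.1 h.2,
      fun h => ⟨formsC_subset h, not_three_dvd_of_mem_formsC h⟩⟩
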